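/- Cubes are cubes in $\mathbb R^n$ ($n\ge 1$) with sides parallel to the axes, $Mf(x)=\sup_{Q\ni x}\frac1{|Q|}\int_Q|f|$ is the Hardy--Littlewood maximal function, a weight is a measurable, a.e. positive, locally integrable function, and a weight $u$ is in $A_1$ if $Mu\le Cu$ a.e. for some finite $C$, the least such $C$ being $[u]_{A_1}$. For a weight function $w$ and $p\ge 1$ let $\|f\|_{L^{p,1}(w)}=p\int_0^\infty w(\{|f|>t\})^{1/p}\,dt$. For $u_0\in A_1$ put $L_{u_0}f=M(u_0f)/u_0$. Let $n\ge 1$, $N\ge 0$, $\alpha_1,\dots,\alpha_N>0$ and $s\ge 1$. There are constants $c,C>0$, depending only on $n$, $s$, $N$ and $\alpha_1,\dots,\alpha_N$, such that the following holds. Let $u_0\in A_1$, let $h_1,\dots,h_N\in L^1_{loc}(\mathbb R^n)$ be not a.e. zero with $Mh_j<\infty$ a.e., and put $\nu=\prod_{j=1}^N (Mh_j)^{-\alpha_j}$. Then there are $p_0>1$ and $K_0>0$ with $$c\,[u_0]_{A_1}\le p_0\le C\,[u_0]_{A_1},\qquad c\,[u_0]_{A_1}^2\le K_0\le C\,[u_0]_{A_1}^2,$$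 such that for every $p\ge p_0$ and every measurable $f$ $$\|L_{u_0}f\|_{L^{p,1}(u_0\nu^s)}\le K_0\,\|f\|_{L^{p,1}(u_0\nu^s)},$$ and such that, for $R_{u_0}h=\sum_{k=0}^\infty \frac{L_{u_0}^kh}{2^kK_0^k}$ with $h\ge 0$ measurable, 1. $h\le R_{u_0}h$; 2. if $h$ is not a.e. zero and $h\in L^{p,1}(u_0\nu^s)$ for some $p\ge p_0$, then $u_0R_{u_0}h\in A_1$ and $[u_0R_{u_0}h]_{A_1}\le 2K_0$; 3. $\|R_{u_0}h\|_{L^{p,1}(u_0\nu^s)}\le 2\,\|h\|_{L^{p,1}(u_0\nu^s)}$ for every $p\ge p_0$. -/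

import Mathlib

open MeasureTheory Filter
open scoped ENNReal

noncomputable section

namespace RestrictedWeights

/-- The uncentred Hardy–Littlewood maximal function of a `[0, ∞]`-valued function on `ℝⁿ`.
`Fin n → ℝ` carries the sup norm, so `Metric.closedBall c r` is the closed cube with sides
parallel to the axes, centre `c` and side length `2 r`.  For a signed `f` apply it to `|f|`. -/
def maximal {n : ℕ} (f : (Fin n → ℝ) → ℝ≥0∞) (x : Fin n → ℝ) : ℝ≥0∞ :=
  ⨆ (c : Fin n → ℝ) (r : ℝ) (_ : 0 < r) (_ : x ∈ Metric.closedBall c r),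
    (∫⁻ y in Metric.closedBall c r, f y) / volume (Metric.closedBall c r)

/-- A weight: measurable, positive almost everywhere and locally integrable
(so also finite almost everywhere). -/
structure IsWeight {n : ℕ} (w : (Fin n → ℝ) → ℝ≥0∞) : Prop where
  aemeasurable : AEMeasurable w
  pos : ∀ᵐ x, 0 < w x
  locallyIntegrable : ∀ K : Set (Fin n → ℝ), IsCompact K → ∫⁻ x in K, w x < ∞

/-- `[w]_{A₁}`: the least `C` with `M w ≤ C w` almost everywhere. -/
def a1Const {n : ℕ} (w : (Fin n → ℝ) → ℝ≥0∞) : ℝ≥0∞ :=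
  sInf {C : ℝ≥0∞ | ∀ᵐ x, maximal w x ≤ C * w x}

/-- The Muckenhoupt class `A₁`. -/
def IsA1 {n : ℕ} (w : (Fin n → ℝ) → ℝ≥0∞) : Prop :=
  IsWeight w ∧ a1Const w < ∞

/-- `∏ⱼ (M hⱼ)^(-αⱼ)`. -/
def maximalProduct {n N : ℕ} (h : Fin N → (Fin n → ℝ) → ℝ) (α : Fin N → ℝ)
    (x : Fin n → ℝ) : ℝ≥0∞ :=
  ∏ j, maximal (fun y => ‖h j y‖ₑ) x ^ (-α j)

/-- The norm of `L^{p,1}(w)`, `∫₀^∞ t^{1/p} f*(t) dt/t = p ∫₀^∞ w({f > t})^{1/p} dt`. -/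
def lorentzNorm {n : ℕ} (p : ℝ) (w f : (Fin n → ℝ) → ℝ≥0∞) : ℝ≥0∞ :=
  ENNReal.ofReal p *
    ∫⁻ t in Set.Ioi (0 : ℝ), (volume.withDensity w {x | ENNReal.ofReal t < f x}) ^ (1 / p)

/-- `L_u f = M (u f) / u`.  It depends on `|f|` only, so it is defined on `[0, ∞]`-valued
functions. -/
def opL {n : ℕ} (u f : (Fin n → ℝ) → ℝ≥0∞) (x : Fin n → ℝ) : ℝ≥0∞ :=
  maximal (fun y => u y * f y) x / u x

/-- `R_u h = ∑ₖ L_u^k h / (2^k K^k)`. -/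
def opR {n : ℕ} (u : (Fin n → ℝ) → ℝ≥0∞) (K : ℝ) (h : (Fin n → ℝ) → ℝ≥0∞)
    (x : Fin n → ℝ) : ℝ≥0∞ :=
  ∑' k : ℕ, (opL u)^[k] h x / ENNReal.ofReal (2 ^ k * K ^ k)

end RestrictedWeights

end

/-!
Write `μ = u dx` with `u ∈ A₁` and `ν = ∏ⱼ (M hⱼ)^(-αⱼ)`.  The level sets of `M u` decay by a
factor `1 - θ / [u]` from one scale to the next, so that small powers of maximal functions,
with total exponent up to a multiple of `1 / [u]`, are `A₁` weights relative to `μ`.  Taking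
`q - 1` to be a large multiple of `[u]`, this applies to `(ν^s)^(-1/(q-1))`; by Hölder's inequality
and a Vitali covering, `L_u` is then of weak type `(q, q)` for `u ν^s`, with a bound polynomial
in `[u]`.  Since `L_u` is also bounded by `[u]` on `L^∞`, splitting `f` at geometric levels improves
this to boundedness on `L^{p,1}(u ν^s)` for `p ≥ 3q`, the gap between `q` and `p` reducing the norm
to order `[u]^2`.  The factor `6` in `K₀ = 6 K` makes the Rubio de Francia series converge in
`L^{p,1}` with constant `2` in spite of the failure of the triangle inequality.
-/

namespace RestrictedWeights

open Metric

variable {n : ℕ}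

/-! ### The maximal function -/

lemma average_le_maximal (f : (Fin n → ℝ) → ℝ≥0∞) {x c : Fin n → ℝ} {r : ℝ} (hr : 0 < r)
    (hx : x ∈ closedBall c r) :
    (∫⁻ y in closedBall c r, f y) / volume (closedBall c r) ≤ maximal f x :=
  le_iSup_of_le c <| le_iSup_of_le r <| le_iSup_of_le hr <| le_iSup_of_le hx le_rfl

lemma lt_maximal_iff {f : (Fin n → ℝ) → ℝ≥0∞} {x : Fin n → ℝ} {t : ℝ≥0∞} :
    t < maximal f x ↔ ∃ (c : Fin n → ℝ) (r : ℝ), 0 < r ∧ x ∈ closedBall c r ∧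
      t < (∫⁻ y in closedBall c r, f y) / volume (closedBall c r) := by
  simp only [maximal, lt_iSup_iff, exists_prop]

lemma maximal_le_iff {f : (Fin n → ℝ) → ℝ≥0∞} {x : Fin n → ℝ} {t : ℝ≥0∞} :
    maximal f x ≤ t ↔ ∀ (c : Fin n → ℝ) (r : ℝ), 0 < r → x ∈ closedBall c r →
      (∫⁻ y in closedBall c r, f y) / volume (closedBall c r) ≤ t := by
  simp only [maximal, iSup_le_iff]

lemma volume_closedBall_ne_zero (c : Fin n → ℝ) {r : ℝ} (hr : 0 < r) :
    volume (closedBall c r) ≠ 0 :=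
  (measure_closedBall_pos _ _ hr).ne'

lemma volume_closedBall_ne_top (c : Fin n → ℝ) (r : ℝ) : volume (closedBall c r) ≠ ∞ :=
  measure_closedBall_lt_top.ne

lemma volume_closedBall_ofNat_mul (c c' : Fin n → ℝ) {k : ℕ} [k.AtLeastTwo] {r : ℝ}
    (hr : 0 ≤ r) :
    volume (closedBall c (ofNat(k) * r)) = ofNat(k) ^ n * volume (closedBall c' r) := by
  rw [Real.volume_pi_closedBall _ (mul_nonneg (Nat.ofNat_nonneg k) hr),
    Real.volume_pi_closedBall _ hr, Fintype.card_fin, mul_left_comm, mul_pow,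
    ENNReal.ofReal_mul (pow_nonneg (Nat.ofNat_nonneg k) n),
    ENNReal.ofReal_pow (Nat.ofNat_nonneg k), ENNReal.ofReal_ofNat]

lemma setLIntegral_closedBall_le (f : (Fin n → ℝ) → ℝ≥0∞) {x c : Fin n → ℝ} {r : ℝ}
    (hr : 0 < r) (hx : x ∈ closedBall c r) :
    ∫⁻ y in closedBall c r, f y ≤ maximal f x * volume (closedBall c r) := by
  rw [← ENNReal.div_le_iff (volume_closedBall_ne_zero c hr) (volume_closedBall_ne_top c r)]
  exact average_le_maximal f hr hx

lemma maximal_mono {f g : (Fin n → ℝ) → ℝ≥0∞} (h : f ≤ g) : maximal f ≤ maximal g :=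
  fun _ => maximal_le_iff.2 fun _ _ hr hx =>
    (ENNReal.div_le_div_right (lintegral_mono h) _).trans (average_le_maximal g hr hx)

lemma isOpen_lt_maximal (f : (Fin n → ℝ) → ℝ≥0∞) (t : ℝ≥0∞) : IsOpen {x | t < maximal f x} := by
  rw [isOpen_iff_mem_nhds]
  intro x hx
  obtain ⟨c, r, hr, hxc, ht⟩ := lt_maximal_iff.1 hx
  have hvol (ρ : ℝ) (hρ : 0 < ρ) : volume (closedBall c ρ) = ENNReal.ofReal ((2 * ρ) ^ n) := by
    rw [Real.volume_pi_closedBall _ hρ.le, Fintype.card_fin]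
  have hcont : Tendsto (fun ρ : ℝ => (∫⁻ y in closedBall c r, f y) / ENNReal.ofReal ((2 * ρ) ^ n))
      (nhdsWithin r (Set.Ioi r))
      (nhds ((∫⁻ y in closedBall c r, f y) / ENNReal.ofReal ((2 * r) ^ n))) :=
    tendsto_nhdsWithin_of_tendsto_nhds <| ENNReal.Tendsto.const_div
      ((ENNReal.continuous_ofReal.comp (by fun_prop)).tendsto r) (Or.inl ENNReal.ofReal_ne_top)
  rw [hvol r hr] at ht
  obtain ⟨ρ, hρt, hrρ : r < ρ⟩ :=
    ((hcont.eventually (lt_mem_nhds ht)).and self_mem_nhdsWithin).exists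
  filter_upwards [isOpen_ball.mem_nhds (hxc.trans_lt hrρ : x ∈ ball c ρ)] with y hy
  refine lt_maximal_iff.2 ⟨c, ρ, hr.trans hrρ, ball_subset_closedBall hy, ?_⟩
  rw [hvol ρ (hr.trans hrρ)]
  refine hρt.trans_le ?_
  gcongr

lemma measurable_maximal (f : (Fin n → ℝ) → ℝ≥0∞) : Measurable (maximal f) :=
  measurable_of_Ioi fun t => (isOpen_lt_maximal f t).measurableSet

lemma maximal_add_le {f g : (Fin n → ℝ) → ℝ≥0∞} (hf : AEMeasurable f) (x : Fin n → ℝ) :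
    maximal (fun y => f y + g y) x ≤ maximal f x + maximal g x := by
  refine maximal_le_iff.2 fun c r hr hx => ?_
  rw [lintegral_add_left' hf.restrict, ENNReal.add_div]
  exact add_le_add (average_le_maximal f hr hx) (average_le_maximal g hr hx)

lemma maximal_tsum_le {ι : Type*} [Countable ι] {f : ι → (Fin n → ℝ) → ℝ≥0∞}
    (hf : ∀ i, AEMeasurable (f i)) (x : Fin n → ℝ) :
    maximal (fun y => ∑' i, f i y) x ≤ ∑' i, maximal (f i) x := by
  refine maximal_le_iff.2 fun c r hr hx => ?_
  rw [lintegral_tsum fun i => (hf i).restrict, ENNReal.div_eq_inv_mul, ← ENNReal.tsum_mul_left]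
  refine ENNReal.tsum_le_tsum fun i => ?_
  rw [← ENNReal.div_eq_inv_mul]
  exact average_le_maximal (f i) hr hx

lemma maximal_const_mul_le {a : ℝ≥0∞} (ha : a ≠ ∞) (f : (Fin n → ℝ) → ℝ≥0∞) (x : Fin n → ℝ) :
    maximal (fun y => a * f y) x ≤ a * maximal f x := by
  refine maximal_le_iff.2 fun c r hr hx => ?_
  rw [lintegral_const_mul' _ _ ha, mul_div_assoc]
  gcongr
  exact average_le_maximal f hr hx

lemma maximal_eq_zero_iff {f : (Fin n → ℝ) → ℝ≥0∞} {x : Fin n → ℝ} :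
    maximal f x = 0 ↔ ∫⁻ y, f y = 0 := by
  refine ⟨fun h => ?_, fun h => ?_⟩
  · have hball (k : ℕ) : ∫⁻ y in closedBall x (k + 1), f y = 0 := by
      have hk : (0 : ℝ) < k + 1 := by positivity
      simpa [h] using setLIntegral_closedBall_le f hk (mem_closedBall_self (x := x) hk.le)
    have hcover : ⋃ k : ℕ, closedBall x ((k : ℝ) + 1) = Set.univ :=
      Set.eq_univ_of_forall fun y => Set.mem_iUnion.2 <|
        (exists_nat_ge (dist y x)).imp fun k hk => hk.trans (le_add_of_nonneg_right zero_le_one)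
    rw [← setLIntegral_univ, ← hcover, ← nonpos_iff_eq_zero]
    exact (lintegral_iUnion_le _ f).trans (by simp [hball])
  · refine nonpos_iff_eq_zero.1 (maximal_le_iff.2 fun c r _ _ => ?_)
    simp [nonpos_iff_eq_zero.1 (h ▸ setLIntegral_le_lintegral (closedBall c r) f)]

lemma maximal_ne_zero {f : (Fin n → ℝ) → ℝ≥0∞} (hf : AEMeasurable f) (h0 : ¬ f =ᵐ[volume] 0)
    (x : Fin n → ℝ) : maximal f x ≠ 0 := by
  rwa [Ne, maximal_eq_zero_iff, lintegral_eq_zero_iff' hf]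

/-! ### Covering estimates -/

section Vitali

variable {X : Type*} [PseudoMetricSpace X] [TopologicalSpace.SeparableSpace X] [MeasurableSpace X]
  [OpensMeasurableSpace X] {μ ρ : Measure X} {S : Set X}

lemma measure_le_of_forall_closedBall_of_radius_le {R : ℝ}
    (hS : ∀ x ∈ S, ∃ (c : X) (r : ℝ), 0 < r ∧ r ≤ R ∧ x ∈ closedBall c r ∧
      μ (closedBall c (5 * r)) ≤ ρ (closedBall c r)) :
    μ S ≤ ρ Set.univ := by
  choose! c r hr hrR hxc hμ using hS
  obtain ⟨v, hvS, hdisj, hcov⟩ := Vitali.exists_disjoint_subfamily_covering_enlargement_closedBall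
    S c r R hrR 5 (by norm_num)
  have hv : v.Countable := hdisj.countable_of_nonempty_interior fun a ha =>
    ⟨c a, mem_interior_iff_mem_nhds.2 (closedBall_mem_nhds _ (hr a (hvS ha)))⟩
  have hcover : S ⊆ ⋃ a ∈ v, closedBall (c a) (5 * r a) := fun x hx =>
    let ⟨b, hb, hsub⟩ := hcov x hx
    Set.mem_biUnion hb (hsub (hxc x hx))
  calc μ S ≤ ∑' a : v, μ (closedBall (c a) (5 * r a)) :=
        (measure_mono hcover).trans (measure_biUnion_le μ hv _)
    _ ≤ ∑' a : v, ρ (closedBall (c a) (r a)) := ENNReal.tsum_le_tsum fun a => hμ a (hvS a.2)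
    _ = ρ (⋃ a ∈ v, closedBall (c a) (r a)) :=
        (measure_biUnion hv hdisj fun _ _ => isClosed_closedBall.measurableSet).symm
    _ ≤ ρ Set.univ := measure_mono (Set.subset_univ _)

lemma measure_le_of_forall_closedBall
    (hS : ∀ x ∈ S, ∃ (c : X) (r : ℝ), 0 < r ∧ x ∈ closedBall c r ∧
      μ (closedBall c (5 * r)) ≤ ρ (closedBall c r)) :
    μ S ≤ ρ Set.univ := by
  let T (k : ℕ) : Set X := {x | ∃ (c : X) (r : ℝ), 0 < r ∧ r ≤ k ∧ x ∈ closedBall c r ∧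
    μ (closedBall c (5 * r)) ≤ ρ (closedBall c r)}
  have hmono : Monotone T := fun k l hkl x ⟨c, r, hr, hrk, h⟩ =>
    ⟨c, r, hr, hrk.trans (Nat.cast_le.2 hkl), h⟩
  have hsub : S ⊆ ⋃ k, T k := fun x hx =>
    let ⟨c, r, hr, h⟩ := hS x hx
    let ⟨k, hk⟩ := exists_nat_ge r
    Set.mem_iUnion.2 ⟨k, c, r, hr, hk, h⟩
  calc μ S ≤ μ (⋃ k, T k) := measure_mono hsub
    _ = ⨆ k, μ (T k) := hmono.measure_iUnion
    _ ≤ ρ Set.univ := iSup_le fun k => measure_le_of_forall_closedBall_of_radius_le fun _ hx => hx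

end Vitali

lemma mul_volume_lt_maximal_le (f : (Fin n → ℝ) → ℝ≥0∞) (t : ℝ≥0∞) :
    t * volume {x | t < maximal f x} ≤ 5 ^ n * ∫⁻ y, f y := by
  have key : (t • volume) {x | t < maximal f x} ≤
      ((5 ^ n : ℝ≥0∞) • volume.withDensity f) Set.univ := by
    refine measure_le_of_forall_closedBall fun x hx => ?_
    obtain ⟨c, r, hr, hxc, h⟩ := lt_maximal_iff.1 hx
    refine ⟨c, r, hr, hxc, ?_⟩
    rw [Measure.smul_apply, Measure.smul_apply, smul_eq_mul, smul_eq_mul, withDensity_apply' f,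
      volume_closedBall_ofNat_mul c c hr.le, mul_left_comm]
    gcongr
    exact ENNReal.mul_le_of_le_div h.le
  simpa only [Measure.smul_apply, smul_eq_mul, withDensity_apply' f, setLIntegral_univ] using key

/-! ### `A₁` weights -/

section A1

variable {u : (Fin n → ℝ) → ℝ≥0∞} {c : Fin n → ℝ} {r : ℝ}

lemma IsWeight.measure_closedBall_ne_top (hu : IsWeight u) (c : Fin n → ℝ) (r : ℝ) :
    volume.withDensity u (closedBall c r) ≠ ∞ := by
  rw [withDensity_apply' u]
  exact (hu.locallyIntegrable _ (isCompact_closedBall c r)).ne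

lemma IsWeight.volume_absolutelyContinuous (hu : IsWeight u) :
    volume ≪ volume.withDensity u :=
  withDensity_absolutelyContinuous' hu.aemeasurable (hu.pos.mono fun _ hx => hx.ne')

lemma IsWeight.measure_closedBall_ne_zero (hu : IsWeight u) (c : Fin n → ℝ) (hr : 0 < r) :
    volume.withDensity u (closedBall c r) ≠ 0 :=
  mt (fun h => hu.volume_absolutelyContinuous h) (volume_closedBall_ne_zero c hr)

lemma IsWeight.ae_lt_top (hu : IsWeight u) : ∀ᵐ x, u x < ∞ := by
  rw [← Measure.restrict_univ (μ := volume), ← iUnion_closedBall_nat (0 : Fin n → ℝ),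
    ae_restrict_iUnion_iff]
  exact fun k => ae_lt_top' hu.aemeasurable.restrict
    (hu.locallyIntegrable _ (isCompact_closedBall _ _)).ne

lemma IsA1.ae_maximal_le (hu : IsA1 u) : ∀ᵐ x, maximal u x ≤ a1Const u * u x := by
  obtain ⟨C, -, hlim, hmem⟩ := exists_seq_tendsto_sInf
    (S := {C : ℝ≥0∞ | ∀ᵐ x, maximal u x ≤ C * u x}) ⟨∞, by
      filter_upwards [hu.1.pos] with x hx
      simp [ENNReal.top_mul hx.ne']⟩ (OrderBot.bddBelow _)
  filter_upwards [ae_all_iff.2 hmem, hu.1.ae_lt_top] with x hx hux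
  exact ge_of_tendsto' (ENNReal.Tendsto.mul_const hlim (Or.inr hux.ne)) hx

lemma IsA1.volume_mul_measure_closedBall_le (hu : IsA1 u) (hr : 0 < r) {E : Set (Fin n → ℝ)}
    (hE : MeasurableSet E) (hsub : E ⊆ closedBall c r) :
    volume E * volume.withDensity u (closedBall c r) ≤
      a1Const u * volume (closedBall c r) * volume.withDensity u E := by
  set Q := closedBall c r
  have havg : ∀ᵐ x, x ∈ E → volume.withDensity u Q / volume Q ≤ a1Const u * u x := by
    filter_upwards [hu.ae_maximal_le] with x hx hxE
    rw [withDensity_apply' u]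
    exact (average_le_maximal u hr (hsub hxE)).trans hx
  have hint := setLIntegral_mono_ae' hE havg
  rw [lintegral_const_mul' _ _ hu.2.ne, ← withDensity_apply' u, setLIntegral_const, mul_comm,
    ← mul_div_assoc, ENNReal.div_le_iff (volume_closedBall_ne_zero c hr)
    (volume_closedBall_ne_top c r)] at hint
  rwa [mul_right_comm]

lemma IsA1.one_le_a1Const (hu : IsA1 u) : 1 ≤ a1Const u := by
  have h := hu.volume_mul_measure_closedBall_le (c := 0) one_pos
    isClosed_closedBall.measurableSet subset_rfl
  rw [mul_assoc] at h
  rwa [← ENNReal.mul_le_mul_iff_left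
    (mul_ne_zero (volume_closedBall_ne_zero 0 one_pos) (hu.1.measure_closedBall_ne_zero 0 one_pos))
    (ENNReal.mul_ne_top (volume_closedBall_ne_top 0 1) (hu.1.measure_closedBall_ne_top 0 1)),
    one_mul]

lemma IsA1.measure_closedBall_five_mul_le (hu : IsA1 u) (c : Fin n → ℝ) (hr : 0 < r) :
    volume.withDensity u (closedBall c (5 * r)) ≤
      5 ^ n * a1Const u * volume.withDensity u (closedBall c r) := by
  have h := hu.volume_mul_measure_closedBall_le (c := c) (by positivity : 0 < 5 * r)
    isClosed_closedBall.measurableSet (closedBall_subset_closedBall (by linarith : r ≤ 5 * r))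
  rw [volume_closedBall_ofNat_mul c c hr.le] at h
  rw [← ENNReal.mul_le_mul_iff_right (volume_closedBall_ne_zero c hr)
    (volume_closedBall_ne_top c r)]
  exact h.trans_eq (by ring)

end A1

/-! ### Decay of the level sets of the maximal function -/

section LevelSets

variable {u f : (Fin n → ℝ) → ℝ≥0∞} {c x y z : Fin n → ℝ} {r : ℝ} {l : ℝ≥0∞}

lemma maximal_le_max_maximal_indicator (f : (Fin n → ℝ) → ℝ≥0∞) {k : ℕ} [k.AtLeastTwo]
    (hy : y ∈ closedBall c r) (hz : dist z c + 2 * r ≤ ofNat(k) * r) :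
    maximal f y ≤
      max (maximal ((closedBall c (3 * r)).indicator f) y) (ofNat(k) ^ n * maximal f z) := by
  refine maximal_le_iff.2 fun c' ρ hρ hyc' => ?_
  rw [mem_closedBall] at hy hyc'
  have hcc' : dist c' c ≤ ρ + r := by linarith [dist_triangle c' y c, dist_comm c' y]
  rcases le_or_gt ρ r with hρr | hrρ
  · have hsub : closedBall c' ρ ⊆ closedBall c (3 * r) :=
      closedBall_subset_closedBall' (by linarith)
    refine le_max_of_le_left (le_trans (le_of_eq ?_) (average_le_maximal _ hρ hyc'))
    congr 1
    exact setLIntegral_congr_fun isClosed_closedBall.measurableSet fun w hw =>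
      (Set.indicator_of_mem (hsub hw) f).symm
  · have hk : (2 : ℝ) ≤ ofNat(k) := Nat.ofNat_le_cast.2 (Nat.AtLeastTwo.prop (n := k))
    have hzc' : z ∈ closedBall c' (ofNat(k) * ρ) := by
      rw [mem_closedBall]
      nlinarith [dist_triangle z c c', dist_comm c c']
    refine le_max_of_le_right ?_
    rw [ENNReal.div_le_iff (volume_closedBall_ne_zero c' hρ) (volume_closedBall_ne_top c' ρ),
      mul_right_comm, ← volume_closedBall_ofNat_mul c' c' hρ.le, mul_comm]
    exact (lintegral_mono_set (closedBall_subset_closedBall (by nlinarith))).trans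
      (setLIntegral_closedBall_le f (by positivity) hzc')

lemma lt_maximal_indicator_subset (f : (Fin n → ℝ) → ℝ≥0∞) (hr : 0 < r)
    (hz : z ∈ closedBall c r) :
    {y | 3 ^ n * maximal f z < maximal ((closedBall c (3 * r)).indicator f) y} ⊆
      closedBall c (5 * r) := by
  intro y hy
  obtain ⟨c', ρ, hρ, hyc', hav⟩ := lt_maximal_iff.1 hy
  have hρr : ρ < r := by
    by_contra! hcon
    refine hav.not_ge ?_
    rw [ENNReal.div_le_iff (volume_closedBall_ne_zero c' hρ) (volume_closedBall_ne_top c' ρ)]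
    calc ∫⁻ w in closedBall c' ρ, (closedBall c (3 * r)).indicator f w
        ≤ ∫⁻ w in closedBall c (3 * r), f w :=
          (setLIntegral_le_lintegral _ _).trans_eq
            (lintegral_indicator isClosed_closedBall.measurableSet f)
      _ ≤ maximal f z * volume (closedBall c (3 * r)) :=
          setLIntegral_closedBall_le f (by positivity)
            (closedBall_subset_closedBall (by linarith) hz)
      _ = 3 ^ n * maximal f z * volume (closedBall c' r) := by
          rw [volume_closedBall_ofNat_mul c c' hr.le]
          ring
      _ ≤ 3 ^ n * maximal f z * volume (closedBall c' ρ) := by gcongr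
  obtain ⟨w, hwc', hwc⟩ : (closedBall c' ρ ∩ closedBall c (3 * r)).Nonempty := by
    by_contra! hcon
    rw [lintegral_indicator isClosed_closedBall.measurableSet,
      Measure.restrict_restrict isClosed_closedBall.measurableSet, Set.inter_comm, hcon] at hav
    simp at hav
  rw [mem_closedBall] at *
  linarith [dist_triangle y c' c, dist_triangle c' w c, dist_comm c' w]

lemma volume_closedBall_le_two_mul_volume_sdiff (hr : 0 < r) (hz : dist z x ≤ 7 * r)
    (hl : l ≠ 0) (hl' : l ≠ ∞) (hfz : maximal f z ≤ l) :
    volume (closedBall x r) ≤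
      2 * volume (closedBall x r \ {y | 2 * 35 ^ n * l < maximal f y}) := by
  set Q := closedBall x r
  set E := {y | 2 * 35 ^ n * l < maximal f y}
  set g := (closedBall x (3 * r)).indicator f
  have hD : (9 : ℝ≥0∞) ^ n ≤ 2 * 35 ^ n :=
    (pow_le_pow_left' (by norm_num) n).trans (le_mul_of_one_le_left' one_le_two)
  have hsub : Q ∩ E ⊆ {y | 2 * 35 ^ n * l < maximal g y} := by
    rintro y ⟨hyQ, hy⟩
    have hmax := maximal_le_max_maximal_indicator f (k := 9) hyQ (z := z) (by linarith)
    exact (lt_max_iff.1 (hy.trans_le hmax)).resolve_right (mul_le_mul' hD hfz).not_gt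
  have hint : ∫⁻ y, g y ≤ 7 ^ n * l * volume Q := by
    rw [lintegral_indicator isClosed_closedBall.measurableSet, mul_right_comm,
      ← volume_closedBall_ofNat_mul x x hr.le, mul_comm _ l]
    exact (lintegral_mono_set (closedBall_subset_closedBall (by linarith))).trans
      ((setLIntegral_closedBall_le f (by positivity) hz).trans (by gcongr))
  have hhalf : 2 * volume (Q ∩ E) ≤ volume Q := by
    have h0 : 35 ^ n * l ≠ 0 := mul_ne_zero (by simp) hl
    have ht : 35 ^ n * l ≠ ∞ := ENNReal.mul_ne_top (by finiteness) hl'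
    rw [← ENNReal.mul_le_mul_iff_right h0 ht]
    calc 35 ^ n * l * (2 * volume (Q ∩ E))
        ≤ 2 * 35 ^ n * l * volume {y | 2 * 35 ^ n * l < maximal g y} := by
          rw [mul_left_comm, ← mul_assoc, ← mul_assoc]
          gcongr
      _ ≤ 5 ^ n * (7 ^ n * l * volume Q) :=
          (mul_volume_lt_maximal_le g _).trans (by gcongr)
      _ = 35 ^ n * l * volume Q := by
          rw [show (35 : ℝ≥0∞) = 5 * 7 by norm_num, mul_pow]
          ring
  have hsplit : volume (Q ∩ E) + volume (Q \ E) = volume Q :=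
    measure_inter_add_sdiff Q (isOpen_lt_maximal f _).measurableSet
  refine (ENNReal.add_le_add_iff_left (volume_closedBall_ne_top x r)).1 ?_
  calc volume Q + volume Q = 2 * volume (Q ∩ E) + 2 * volume (Q \ E) := by
        rw [← two_mul, ← mul_add, hsplit]
    _ ≤ volume Q + 2 * volume (Q \ E) := by gcongr

lemma IsA1.measure_lt_maximal_le_mul_measure_sdiff (hu : IsA1 u) (hl : l ≠ 0) (hl' : l ≠ ∞)
    (hfz : maximal f z ≤ l) :
    volume.withDensity u {y | l < maximal f y} ≤ 2 * 5 ^ n * a1Const u *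
      volume.withDensity u ({y | l < maximal f y} \ {y | 2 * 35 ^ n * l < maximal f y}) := by
  set μ := volume.withDensity u
  set E := {y | l < maximal f y}
  set E' := {y | 2 * 35 ^ n * l < maximal f y}
  have hE : IsOpen E := isOpen_lt_maximal f l
  have hE' : MeasurableSet E' := (isOpen_lt_maximal f _).measurableSet
  have hne : Eᶜ.Nonempty := ⟨z, hfz.not_gt⟩
  suffices μ E ≤ ((2 * 5 ^ n * a1Const u) • μ.restrict (E \ E')) Set.univ by
    simpa only [Measure.smul_apply, smul_eq_mul, Measure.restrict_apply_univ] using this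
  refine measure_le_of_forall_closedBall fun x hx => ?_
  have hd : 0 < infDist x Eᶜ :=
    (hE.isClosed_compl.notMem_iff_infDist_pos hne).1 (Set.notMem_compl_iff.2 hx)
  obtain ⟨r, hr⟩ : ∃ r, infDist x Eᶜ = 6 * r := ⟨infDist x Eᶜ / 6, by ring⟩
  have hr0 : 0 < r := by linarith
  obtain ⟨w, hwE, hw⟩ := (infDist_lt_iff hne).1 (by linarith : infDist x Eᶜ < 7 * r)
  have hQE : closedBall x r ⊆ E := by
    rw [← Set.disjoint_compl_right_iff_subset]
    exact disjoint_closedBall_of_lt_infDist (by linarith)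
  have hhalf := volume_closedBall_le_two_mul_volume_sdiff (z := w) hr0
    (dist_comm x w ▸ hw.le) hl hl' (not_lt.1 hwE)
  refine ⟨x, r, hr0, mem_closedBall_self hr0.le, ?_⟩
  rw [Measure.smul_apply, smul_eq_mul, Measure.restrict_apply isClosed_closedBall.measurableSet,
    ← Set.inter_sdiff_assoc, Set.inter_eq_left.2 hQE]
  set Q := closedBall x r
  have hA1 := hu.volume_mul_measure_closedBall_le (c := x) (by positivity : 0 < 5 * r)
    (isClosed_closedBall.measurableSet.diff hE')
    (Set.sdiff_subset.trans (closedBall_subset_closedBall (by linarith : r ≤ 5 * r)))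
  rw [← ENNReal.mul_le_mul_iff_right (volume_closedBall_ne_zero x hr0)
    (volume_closedBall_ne_top x r)]
  calc volume Q * μ (closedBall x (5 * r))
      ≤ 2 * (volume (Q \ E') * μ (closedBall x (5 * r))) := by
        rw [← mul_assoc]
        gcongr
    _ ≤ 2 * (a1Const u * (5 ^ n * volume Q) * μ (Q \ E')) := by
        rw [← volume_closedBall_ofNat_mul x x hr0.le]
        gcongr
    _ = volume Q * (2 * 5 ^ n * a1Const u * μ (Q \ E')) := by ring

lemma IsA1.measure_lt_maximal_le (hu : IsA1 u) (hl : l ≠ 0) (hl' : l ≠ ∞)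
    (hfz : maximal f z ≤ l) (hfin : volume.withDensity u {y | l < maximal f y} ≠ ∞) :
    volume.withDensity u {y | 2 * 35 ^ n * l < maximal f y} ≤
      (1 - (2 * 5 ^ n * a1Const u)⁻¹) * volume.withDensity u {y | l < maximal f y} := by
  have hbound := hu.measure_lt_maximal_le_mul_measure_sdiff hl hl' hfz
  set μ := volume.withDensity u
  set E := {y | l < maximal f y}
  set E' := {y | 2 * 35 ^ n * l < maximal f y}
  set B := 2 * 5 ^ n * a1Const u
  have hD : (1 : ℝ≥0∞) ≤ 2 * 35 ^ n :=
    one_le_mul one_le_two (one_le_pow₀ (by norm_num))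
  have hsub : E' ⊆ E := fun y hy => (le_mul_of_one_le_left' hD).trans_lt hy
  have hE' : MeasurableSet E' := (isOpen_lt_maximal f _).measurableSet
  have hB0 : B ≠ 0 := mul_ne_zero (by simp) (zero_lt_one.trans_le hu.one_le_a1Const).ne'
  have hBt : B ≠ ∞ := ENNReal.mul_ne_top (by finiteness) hu.2.ne
  rw [ENNReal.sub_mul fun _ _ => hfin, one_mul]
  refine ENNReal.le_sub_of_add_le_left (ENNReal.mul_ne_top (ENNReal.inv_ne_top.2 hB0) hfin) ?_
  calc B⁻¹ * μ E + μ E' ≤ μ (E \ E') + μ E' := by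
        gcongr
        rwa [ENNReal.inv_mul_le_iff hB0 hBt]
    _ = μ E := by
        nth_rw 2 [← Set.inter_eq_right.2 hsub]
        exact measure_sdiff_add_inter E hE'

end LevelSets

section Layers

variable {D l x : ℝ≥0∞} {δ : ℝ}

lemma rpow_le_tsum_indicator (hD : 1 ≤ D) (hl : l ≠ 0) (hlx : l < x) (hδ : 0 ≤ δ) :
    x ^ δ ≤ ∑' k : ℕ, {t | D ^ k * l < t}.indicator (fun _ => (D ^ (k + 1) * l) ^ δ) x := by
  by_cases! hall : ∀ k, D ^ k * l < x → D ^ (k + 1) * l < x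
  · have hlt (k : ℕ) : D ^ k * l < x := Nat.rec (by simpa using hlx) hall k
    have hterm (k : ℕ) :
        l ^ δ ≤ {t | D ^ k * l < t}.indicator (fun _ => (D ^ (k + 1) * l) ^ δ) x := by
      rw [Set.indicator_of_mem (by exact hlt k)]
      gcongr
      exact le_mul_of_one_le_left' (one_le_pow₀ hD)
    have hpos : l ^ δ ≠ 0 := (ENNReal.rpow_pos (pos_iff_ne_zero.2 hl) hlx.ne_top).ne'
    calc x ^ δ ≤ ∞ := le_top
      _ = ∑' _ : ℕ, l ^ δ := (ENNReal.tsum_const_eq_top_of_ne_zero hpos).symm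
      _ ≤ _ := ENNReal.tsum_le_tsum hterm
  · obtain ⟨k, hk, hk'⟩ := hall
    refine le_trans ?_ (ENNReal.le_tsum k)
    rw [Set.indicator_of_mem (by exact hk)]
    gcongr

variable {X : Type*} [MeasurableSpace X] {μ : Measure X} {f : X → ℝ≥0∞}

lemma setLIntegral_lt_rpow_le_tsum (hf : AEMeasurable f μ) (hD : 1 ≤ D) (hl : l ≠ 0)
    (hδ : 0 ≤ δ) :
    ∫⁻ x in {x | l < f x}, f x ^ δ ∂μ ≤
      ∑' k : ℕ, (D ^ (k + 1) * l) ^ δ * μ {x | D ^ k * l < f x} := by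
  have hmeas (a : ℝ≥0∞) : NullMeasurableSet {x | a < f x} μ :=
    nullMeasurableSet_lt aemeasurable_const hf
  rw [← lintegral_indicator₀ (hmeas l)]
  calc ∫⁻ x, {x | l < f x}.indicator (fun x => f x ^ δ) x ∂μ
      ≤ ∫⁻ x, ∑' k : ℕ,
          {x | D ^ k * l < f x}.indicator (fun _ => (D ^ (k + 1) * l) ^ δ) x ∂μ :=
        lintegral_mono <| Set.indicator_le fun x hx => rpow_le_tsum_indicator hD hl hx hδ
    _ = ∑' k : ℕ, (D ^ (k + 1) * l) ^ δ * μ {x | D ^ k * l < f x} := by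
        rw [lintegral_tsum fun k => aemeasurable_const.indicator₀ (hmeas _)]
        simp only [lintegral_indicator₀ (hmeas _), setLIntegral_const]

lemma setLIntegral_lt_rpow_le_of_geometric {q m : ℝ≥0∞} (hf : AEMeasurable f μ) (hD : 1 ≤ D)
    (hl : l ≠ 0) (hδ : 0 ≤ δ) (hμ : ∀ k : ℕ, μ {x | D ^ k * l < f x} ≤ q ^ k * m) :
    ∫⁻ x in {x | l < f x}, f x ^ δ ∂μ ≤ D ^ δ * l ^ δ * (1 - D ^ δ * q)⁻¹ * m := by
  calc ∫⁻ x in {x | l < f x}, f x ^ δ ∂μ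
      ≤ ∑' k : ℕ, (D ^ (k + 1) * l) ^ δ * μ {x | D ^ k * l < f x} :=
        setLIntegral_lt_rpow_le_tsum hf hD hl hδ
    _ ≤ ∑' k : ℕ, D ^ δ * l ^ δ * m * (D ^ δ * q) ^ k := by
        refine ENNReal.tsum_le_tsum fun k => ?_
        calc (D ^ (k + 1) * l) ^ δ * μ {x | D ^ k * l < f x}
            ≤ (D ^ δ) ^ (k + 1) * l ^ δ * (q ^ k * m) := by
              rw [ENNReal.mul_rpow_of_nonneg _ _ hδ, ← ENNReal.rpow_natCast_mul, mul_comm _ δ,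
                ENNReal.rpow_mul_natCast]
              gcongr
              exact hμ k
          _ = D ^ δ * l ^ δ * m * (D ^ δ * q) ^ k := by ring
    _ = D ^ δ * l ^ δ * (1 - D ^ δ * q)⁻¹ * m := by
        rw [ENNReal.tsum_mul_left, ENNReal.tsum_geometric, mul_right_comm]

end Layers

/-! ### Relative `A₁` weights -/

/-- The `A₁` condition with respect to a measure `μ` other than Lebesgue measure: the `μ`-average
of `v` over a cube is at most `K` times the value of `v` at any point of the cube. -/
def IsRelativeA1 (μ : Measure (Fin n → ℝ)) (K : ℝ≥0∞) (v : (Fin n → ℝ) → ℝ≥0∞) : Prop :=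
  ∀ (c z : Fin n → ℝ) (r : ℝ), 0 < r → z ∈ closedBall c r →
    ∫⁻ y in closedBall c r, v y ∂μ ≤ K * v z * μ (closedBall c r)

lemma isRelativeA1_one (μ : Measure (Fin n → ℝ)) {K : ℝ≥0∞} (hK : 1 ≤ K) :
    IsRelativeA1 μ K fun _ => 1 := fun c z r _ _ => by
  simpa using le_mul_of_one_le_left' hK

lemma prod_const_rpow {ι : Type*} (s : Finset ι) {θ : ι → ℝ} (hθ : ∀ i ∈ s, 0 ≤ θ i) (a : ℝ≥0∞) :
    ∏ i ∈ s, a ^ θ i = a ^ ∑ i ∈ s, θ i := by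
  induction s using Finset.cons_induction with
  | empty => simp
  | cons i s hi ih =>
    rw [Finset.forall_mem_cons] at hθ
    rw [Finset.prod_cons, Finset.sum_cons, ih hθ.2,
      ENNReal.rpow_add_of_nonneg _ _ hθ.1 (Finset.sum_nonneg hθ.2)]

lemma IsRelativeA1.prod_rpow {ι : Type*} [Fintype ι] {μ : Measure (Fin n → ℝ)} {K : ℝ≥0∞}
    {v : ι → (Fin n → ℝ) → ℝ≥0∞} {θ : ι → ℝ} (hv : ∀ i, IsRelativeA1 μ K (v i))
    (hm : ∀ i, AEMeasurable (v i) μ) (hθ : ∀ i, 0 ≤ θ i) (hθ1 : ∑ i, θ i = 1) :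
    IsRelativeA1 μ K fun y => ∏ i, v i y ^ θ i := by
  intro c z r hr hz
  calc ∫⁻ y in closedBall c r, ∏ i, v i y ^ θ i ∂μ
      ≤ ∏ i, (∫⁻ y in closedBall c r, v i y ∂μ) ^ θ i :=
        ENNReal.lintegral_prod_norm_pow_le _ (fun i _ => (hm i).restrict) hθ1 fun i _ => hθ i
    _ ≤ ∏ i, (K * v i z * μ (closedBall c r)) ^ θ i := by
        gcongr with i
        · exact hθ i
        · exact hv i c z r hr hz
    _ = ∏ i, (K * μ (closedBall c r)) ^ θ i * v i z ^ θ i := by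
        refine Finset.prod_congr rfl fun i _ => ?_
        rw [mul_right_comm, ENNReal.mul_rpow_of_nonneg _ _ (hθ i)]
    _ = K * (∏ i, v i z ^ θ i) * μ (closedBall c r) := by
        rw [Finset.prod_mul_distrib, prod_const_rpow _ fun i _ => hθ i, hθ1, ENNReal.rpow_one,
          mul_right_comm]

lemma rpow_le_one_add_ofReal_mul {a : ℝ≥0∞} (ha : 1 ≤ a) (ha' : a ≠ ∞) {δ : ℝ} (hδ : 0 ≤ δ)
    (hδ1 : δ ≤ 1) : a ^ δ ≤ 1 + ENNReal.ofReal δ * a := by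
  lift a to NNReal using ha'
  have ha1 : (1 : ℝ) ≤ a := by exact_mod_cast ha
  have hbernoulli : (a : ℝ) ^ δ ≤ 1 + δ * a := by
    have h := rpow_one_add_le_one_add_mul_self (s := (a : ℝ) - 1) (by linarith) hδ hδ1
    rw [add_sub_cancel] at h
    nlinarith
  rw [← ENNReal.ofReal_coe_nnreal, ENNReal.ofReal_rpow_of_nonneg (by positivity) hδ,
    ← ENNReal.ofReal_mul hδ, ← ENNReal.ofReal_one, ← ENNReal.ofReal_add zero_le_one (by positivity)]
  exact ENNReal.ofReal_le_ofReal hbernoulli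

lemma le_one_sub_mul_one_sub {a x : ℝ≥0∞} (hx : 2 * x ≤ 1) (ha : a ≤ 1 + x) :
    x ≤ 1 - a * (1 - 2 * x) := by
  have hat : a ≠ ∞ := by
    have : x ≠ ∞ := fun h => by simp [h] at hx
    exact ne_top_of_le_ne_top (by finiteness) ha
  refine ENNReal.le_sub_of_add_le_right (by finiteness) ?_
  calc x + a * (1 - 2 * x) ≤ x + (1 + x) * (1 - 2 * x) := by gcongr
    _ = x + (1 - 2 * x) + x * (1 - 2 * x) := by ring
    _ ≤ x + (1 - 2 * x) + x * 1 := by gcongr; exact tsub_le_self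
    _ = 1 - 2 * x + 2 * x := by ring
    _ = 1 := tsub_add_cancel_of_le hx

section MaximalRelativeA1

variable {u : (Fin n → ℝ) → ℝ≥0∞} {c y z : Fin n → ℝ} {r δ : ℝ}

lemma IsA1.le_one_of_ofReal_le (hu : IsA1 u)
    (hδu : ENNReal.ofReal δ ≤ (8 * 175 ^ n * a1Const u)⁻¹) : δ ≤ 1 := by
  refine ENNReal.ofReal_le_one.1 (hδu.trans (ENNReal.inv_le_one.2 ?_))
  exact one_le_mul (one_le_mul (by norm_num) (one_le_pow₀ (by norm_num))) hu.one_le_a1Const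

lemma rpow_three_pow_mul_le (hδ : 0 ≤ δ) (hδ1 : δ ≤ 1) (a : ℝ≥0∞) :
    (3 ^ n * a) ^ δ ≤ 3 ^ n * a ^ δ := by
  rw [ENNReal.mul_rpow_of_nonneg _ _ hδ]
  gcongr
  simpa using ENNReal.rpow_le_rpow_of_exponent_le (one_le_pow₀ (n := n) (by norm_num)) hδ1

lemma IsA1.measure_lt_maximal_indicator_le (hu : IsA1 u) (f : (Fin n → ℝ) → ℝ≥0∞) (hr : 0 < r)
    (hz : z ∈ closedBall c r) (h0 : maximal f z ≠ 0) (ht : maximal f z ≠ ∞) (k : ℕ) :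
    volume.withDensity u {y | (2 * 35 ^ n) ^ k * (3 ^ n * maximal f z) <
        maximal ((closedBall c (3 * r)).indicator f) y} ≤
      (1 - (2 * 5 ^ n * a1Const u)⁻¹) ^ k *
        (5 ^ n * a1Const u * volume.withDensity u (closedBall c r)) := by
  set μ := volume.withDensity u
  set D : ℝ≥0∞ := 2 * 35 ^ n
  set l := 3 ^ n * maximal f z
  set g := (closedBall c (3 * r)).indicator f
  have hD (k : ℕ) : 1 ≤ D ^ k := one_le_pow₀ (one_le_mul one_le_two (one_le_pow₀ (by norm_num)))
  have hball (k : ℕ) : {y | D ^ k * l < maximal g y} ⊆ closedBall c (5 * r) := fun y hy =>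
    lt_maximal_indicator_subset f hr hz ((le_mul_of_one_le_left' (hD k)).trans_lt hy)
  have hgz (k : ℕ) : maximal g z ≤ D ^ k * l :=
    ((maximal_mono (Set.indicator_le_self _ f) z).trans
      (le_mul_of_one_le_left' (one_le_pow₀ (by norm_num)))).trans (le_mul_of_one_le_left' (hD k))
  induction k with
  | zero =>
    rw [pow_zero (1 - _), one_mul]
    exact (measure_mono (hball 0)).trans (hu.measure_closedBall_five_mul_le c hr)
  | succ k ih =>
    have hstep := hu.measure_lt_maximal_le (mul_ne_zero (by simp [D]) (mul_ne_zero (by simp) h0))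
      (by finiteness) (hgz k)
      (ne_top_of_le_ne_top (hu.1.measure_closedBall_ne_top _ _) (measure_mono (hball k)))
    rw [pow_succ', pow_succ', mul_assoc D, mul_assoc (1 - _)]
    exact hstep.trans (by gcongr)

lemma IsA1.rpow_le_one_add_inv_div_two (hu : IsA1 u) (hδ : 0 ≤ δ)
    (hδu : ENNReal.ofReal δ ≤ (8 * 175 ^ n * a1Const u)⁻¹) :
    (2 * 35 ^ n : ℝ≥0∞) ^ δ ≤ 1 + (2 * 5 ^ n * a1Const u)⁻¹ / 2 := by
  set D : ℝ≥0∞ := 2 * 35 ^ n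
  set B := 2 * 5 ^ n * a1Const u
  have hD : 1 ≤ D := one_le_mul one_le_two (one_le_pow₀ (by norm_num))
  have hfactor : 8 * 175 ^ n * a1Const u = D * (2 * B) := by
    rw [show (175 : ℝ≥0∞) = 35 * 5 by norm_num, mul_pow]
    ring
  have hδD : ENNReal.ofReal δ * D ≤ B⁻¹ / 2 := by
    refine ENNReal.mul_le_of_le_div (hδu.trans_eq ?_)
    rw [hfactor, ENNReal.mul_inv (.inl (by simp [D])) (.inl (by finiteness)),
      ENNReal.mul_inv (a := 2) (b := B) (.inl two_ne_zero) (.inl ENNReal.ofNat_ne_top),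
      div_eq_mul_inv, div_eq_mul_inv, mul_comm D⁻¹, mul_comm 2⁻¹]
  exact (rpow_le_one_add_ofReal_mul hD (by finiteness) hδ (hu.le_one_of_ofReal_le hδu)).trans
    (by gcongr)

lemma IsA1.setLIntegral_lt_maximal_indicator_rpow_le (hu : IsA1 u) (f : (Fin n → ℝ) → ℝ≥0∞)
    (hδ : 0 ≤ δ) (hδu : ENNReal.ofReal δ ≤ (8 * 175 ^ n * a1Const u)⁻¹)
    (hr : 0 < r) (hz : z ∈ closedBall c r) (h0 : maximal f z ≠ 0) (ht : maximal f z ≠ ∞) :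
    ∫⁻ y in {y | 3 ^ n * maximal f z < maximal ((closedBall c (3 * r)).indicator f) y},
        maximal ((closedBall c (3 * r)).indicator f) y ^ δ ∂(volume.withDensity u) ≤
      8 * 75 ^ n * a1Const u ^ 2 * maximal f z ^ δ * volume.withDensity u (closedBall c r) := by
  set μ := volume.withDensity u
  set D : ℝ≥0∞ := 2 * 35 ^ n
  set l := 3 ^ n * maximal f z
  set B := 2 * 5 ^ n * a1Const u
  set X := B⁻¹ / 2
  have hD : 1 ≤ D := one_le_mul one_le_two (one_le_pow₀ (by norm_num))
  have hB : 1 ≤ B :=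
    one_le_mul (one_le_mul one_le_two (one_le_pow₀ (by norm_num))) hu.one_le_a1Const
  have hX : 2 * X = B⁻¹ := ENNReal.mul_div_cancel two_ne_zero ENNReal.ofNat_ne_top
  have hX1 : 2 * X ≤ 1 := hX ▸ ENNReal.inv_le_one.2 hB
  have hδ1 : δ ≤ 1 := hu.le_one_of_ofReal_le hδu
  have hDδ : D ^ δ ≤ 1 + X := hu.rpow_le_one_add_inv_div_two hδ hδu
  have hlδ : l ^ δ ≤ 3 ^ n * maximal f z ^ δ := rpow_three_pow_mul_le hδ hδ1 _
  calc ∫⁻ y in {y | l < maximal _ y}, maximal _ y ^ δ ∂μ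
      ≤ D ^ δ * l ^ δ * (1 - D ^ δ * (1 - 2 * X))⁻¹ * (5 ^ n * a1Const u * μ (closedBall c r)) :=
        setLIntegral_lt_rpow_le_of_geometric (measurable_maximal _).aemeasurable hD
          (mul_ne_zero (by simp) h0) hδ
          (hX ▸ hu.measure_lt_maximal_indicator_le f hr hz h0 ht)
    _ ≤ 2 * (3 ^ n * maximal f z ^ δ) * X⁻¹ * (5 ^ n * a1Const u * μ (closedBall c r)) := by
        gcongr
        · calc D ^ δ ≤ 1 + X := hDδ
            _ ≤ 1 + 2 * X := by gcongr; exact le_mul_of_one_le_left' one_le_two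
            _ ≤ 1 + 1 := by gcongr
            _ = 2 := one_add_one_eq_two
        · exact le_one_sub_mul_one_sub hX1 hDδ
    _ = 8 * 75 ^ n * a1Const u ^ 2 * maximal f z ^ δ * μ (closedBall c r) := by
        have hXinv : X⁻¹ = 2 * (2 * 5 ^ n * a1Const u) := by
          rw [ENNReal.inv_div (.inl ENNReal.ofNat_ne_top) (.inl two_ne_zero), div_eq_mul_inv,
            inv_inv]
        rw [hXinv, show (75 : ℝ≥0∞) = 3 * 5 * 5 by norm_num, mul_pow, mul_pow]
        ring

lemma maximal_rpow_le_add_indicator (f : (Fin n → ℝ) → ℝ≥0∞) (hδ : 0 ≤ δ)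
    (hz : z ∈ closedBall c r) (hy : y ∈ closedBall c r) :
    maximal f y ^ δ ≤ (3 ^ n * maximal f z) ^ δ +
      {x | 3 ^ n * maximal f z < maximal ((closedBall c (3 * r)).indicator f) x}.indicator
        (fun x => maximal ((closedBall c (3 * r)).indicator f) x ^ δ) y := by
  set l := 3 ^ n * maximal f z
  set g := (closedBall c (3 * r)).indicator f
  have hmax : maximal f y ≤ max (maximal g y) l :=
    maximal_le_max_maximal_indicator f (k := 3) hy (by rw [mem_closedBall] at hz; linarith)
  rcases le_or_gt (maximal g y) l with h | h
  · rw [max_eq_right h] at hmax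
    exact le_add_right (by gcongr)
  · rw [max_eq_left h.le] at hmax
    rw [Set.indicator_of_mem (by exact h)]
    exact le_add_left (by gcongr)

lemma IsA1.isRelativeA1_maximal_rpow (hu : IsA1 u) (f : (Fin n → ℝ) → ℝ≥0∞)
    (hδ : 0 < δ) (hδu : ENNReal.ofReal δ ≤ (8 * 175 ^ n * a1Const u)⁻¹) :
    IsRelativeA1 (volume.withDensity u) (9 * 75 ^ n * a1Const u ^ 2) fun y => maximal f y ^ δ := by
  intro c z r hr hz
  set μ := volume.withDensity u
  set g := (closedBall c (3 * r)).indicator f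
  set l := 3 ^ n * maximal f z
  have hA : 1 ≤ a1Const u := hu.one_le_a1Const
  rcases eq_or_ne (maximal f z) 0 with h0 | h0
  · have hf0 : maximal f = 0 := funext fun y => maximal_eq_zero_iff.2 (maximal_eq_zero_iff.1 h0)
    simp [hf0, ENNReal.zero_rpow_of_pos hδ]
  rcases eq_or_ne (maximal f z) ∞ with ht | ht
  · have hK : 9 * 75 ^ n * a1Const u ^ 2 ≠ 0 := by
      simp [(one_pos.trans_le hA).ne']
    beta_reduce
    rw [ht, ENNReal.top_rpow_of_pos hδ, ENNReal.mul_top hK,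
      ENNReal.top_mul (hu.1.measure_closedBall_ne_zero c hr)]
    exact le_top
  calc ∫⁻ y in closedBall c r, maximal f y ^ δ ∂μ
      ≤ ∫⁻ y in closedBall c r,
          (l ^ δ + {y | l < maximal g y}.indicator (fun y => maximal g y ^ δ) y) ∂μ :=
        setLIntegral_mono' isClosed_closedBall.measurableSet fun y hy =>
          maximal_rpow_le_add_indicator f hδ.le hz hy
    _ ≤ l ^ δ * μ (closedBall c r) + ∫⁻ y in {y | l < maximal g y}, maximal g y ^ δ ∂μ := by
        rw [lintegral_add_left measurable_const, setLIntegral_const,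
          ← lintegral_indicator (measurableSet_lt measurable_const (measurable_maximal g))]
        exact add_le_add le_rfl (setLIntegral_le_lintegral _ _)
    _ ≤ 75 ^ n * a1Const u ^ 2 * maximal f z ^ δ * μ (closedBall c r) +
          8 * 75 ^ n * a1Const u ^ 2 * maximal f z ^ δ * μ (closedBall c r) := by
        gcongr ?_ * _ + ?_
        · calc l ^ δ ≤ 3 ^ n * 1 ^ 2 * maximal f z ^ δ := by
                rw [one_pow, mul_one]
                exact rpow_three_pow_mul_le hδ.le (hu.le_one_of_ofReal_le hδu) _
            _ ≤ _ := by gcongr; norm_num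
        · exact hu.setLIntegral_lt_maximal_indicator_rpow_le f hδ.le hδu hr hz h0 ht
    _ = 9 * 75 ^ n * a1Const u ^ 2 * maximal f z ^ δ * μ (closedBall c r) := by ring

end MaximalRelativeA1

/-! ### The weak type inequality -/

section WeakType

lemma rpow_lintegral_le {X : Type*} [MeasurableSpace X] {μ : Measure X} {f ν : X → ℝ≥0∞} {q : ℝ}
    (hq : 1 < q) (hf : AEMeasurable f μ) (hν : AEMeasurable ν μ) (hν0 : ∀ᵐ x ∂μ, ν x ≠ 0)
    (hνt : ∀ᵐ x ∂μ, ν x ≠ ∞) :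
    (∫⁻ x, f x ∂μ) ^ q ≤
      (∫⁻ x, f x ^ q * ν x ∂μ) * (∫⁻ x, ν x ^ (-1 / (q - 1)) ∂μ) ^ (q - 1) := by
  have hq0 : 0 < q := by linarith
  have hq1 : q - 1 ≠ 0 := by linarith
  have hsplit : ∫⁻ x, f x ∂μ = ∫⁻ x, f x * ν x ^ (1 / q) * ν x ^ (-(1 / q)) ∂μ := by
    refine lintegral_congr_ae ?_
    filter_upwards [hν0, hνt] with x hx0 hxt
    rw [mul_assoc, ← ENNReal.rpow_add _ _ hx0 hxt, add_neg_cancel, ENNReal.rpow_zero, mul_one]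
  have hleft (x : X) : (f x * ν x ^ (1 / q)) ^ q = f x ^ q * ν x := by
    rw [ENNReal.mul_rpow_of_nonneg _ _ hq0.le, ← ENNReal.rpow_mul, one_div_mul_cancel hq0.ne',
      ENNReal.rpow_one]
  have hright (x : X) : (ν x ^ (-(1 / q))) ^ (q / (q - 1)) = ν x ^ (-1 / (q - 1)) := by
    rw [← ENNReal.rpow_mul]
    congr 1
    field_simp
  have hholder := ENNReal.lintegral_mul_le_Lp_mul_Lq μ (Real.HolderConjugate.conjExponent hq)
    (hf.mul (hν.pow_const (1 / q))) (hν.pow_const (-(1 / q)))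
  simp only [Pi.mul_apply, Real.conjExponent, hleft, hright, ← hsplit] at hholder
  calc (∫⁻ x, f x ∂μ) ^ q ≤ _ := ENNReal.rpow_le_rpow hholder hq0.le
    _ = _ := by
      rw [ENNReal.mul_rpow_of_nonneg _ _ hq0.le, ← ENNReal.rpow_mul, ← ENNReal.rpow_mul,
        one_div_mul_cancel hq0.ne', ENNReal.rpow_one]
      congr 2
      field_simp

variable {μ : Measure (Fin n → ℝ)} {K : ℝ≥0∞} {u ν f : (Fin n → ℝ) → ℝ≥0∞} {c : Fin n → ℝ}
  {r q : ℝ}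

/- The `A_q` condition for the weight `ν` over `μ`, obtained from the factorisation
`ν = (ν ^ (-1 / (q - 1))) ^ (1 - q)`. -/
lemma IsRelativeA1.withDensity_closedBall_mul_le
    (h : IsRelativeA1 μ K fun y => ν y ^ (-1 / (q - 1))) (hK : 1 ≤ K) (hq : 1 < q)
    (hν : AEMeasurable ν μ) (hr : 0 < r) :
    μ.withDensity ν (closedBall c r) *
      (∫⁻ y in closedBall c r, ν y ^ (-1 / (q - 1)) ∂μ) ^ (q - 1) ≤
        (K * μ (closedBall c r)) ^ q := by
  set Q := closedBall c r
  set S := ∫⁻ y in Q, ν y ^ (-1 / (q - 1)) ∂μ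
  have hq1 : 0 < q - 1 := by linarith
  have hQ : MeasurableSet Q := isClosed_closedBall.measurableSet
  have hpt {z} (hz : z ∈ Q) : ν z * S ^ (q - 1) ≤ (K * μ Q) ^ (q - 1) :=
    calc ν z * S ^ (q - 1) ≤ ν z * (K * ν z ^ (-1 / (q - 1)) * μ Q) ^ (q - 1) := by
          gcongr
          exact h c z r hr hz
      _ = ν z * (ν z)⁻¹ * (K * μ Q) ^ (q - 1) := by
          rw [mul_right_comm, ENNReal.mul_rpow_of_nonneg _ _ hq1.le, ← ENNReal.rpow_mul,
            div_mul_cancel₀ _ hq1.ne', ENNReal.rpow_neg_one]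
          ring
      _ ≤ (K * μ Q) ^ (q - 1) := mul_le_of_le_one_left' (ENNReal.mul_inv_le_one _)
  calc μ.withDensity ν Q * S ^ (q - 1) = ∫⁻ z in Q, ν z * S ^ (q - 1) ∂μ := by
        rw [withDensity_apply _ hQ, lintegral_mul_const'' _ hν.restrict]
    _ ≤ (K * μ Q) ^ (q - 1) * μ Q := by
        rw [← setLIntegral_const]
        exact setLIntegral_mono' hQ fun z hz => hpt hz
    _ ≤ (K * μ Q) ^ (q - 1) * (K * μ Q) ^ (1 : ℝ) := by
        rw [ENNReal.rpow_one]
        gcongr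
        exact le_mul_of_one_le_left' hK
    _ = (K * μ Q) ^ q := by
        rw [← ENNReal.rpow_add_of_nonneg _ _ hq1.le zero_le_one, sub_add_cancel]

lemma IsRelativeA1.withDensity_closedBall_mul_rpow_setLIntegral_le
    (h : IsRelativeA1 μ K fun y => ν y ^ (-1 / (q - 1))) (hK : 1 ≤ K) (hq : 1 < q)
    (hf : AEMeasurable f μ) (hν : AEMeasurable ν μ) (hν0 : ∀ᵐ x ∂μ, ν x ≠ 0)
    (hνt : ∀ᵐ x ∂μ, ν x ≠ ∞) (hr : 0 < r) {s : Set (Fin n → ℝ)} (hs : s ⊆ closedBall c r) :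
    μ.withDensity ν (closedBall c r) * (∫⁻ y in s, f y ∂μ) ^ q ≤
      (K * μ (closedBall c r)) ^ q * ∫⁻ y in s, f y ^ q * ν y ∂μ := by
  set Q := closedBall c r
  set F := ∫⁻ y in s, f y ^ q * ν y ∂μ
  calc μ.withDensity ν Q * (∫⁻ y in s, f y ∂μ) ^ q
      ≤ μ.withDensity ν Q * (F * (∫⁻ y in s, ν y ^ (-1 / (q - 1)) ∂μ) ^ (q - 1)) := by
        gcongr
        exact rpow_lintegral_le hq hf.restrict hν.restrict (ae_restrict_of_ae hν0)
          (ae_restrict_of_ae hνt)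
    _ ≤ μ.withDensity ν Q * (F * (∫⁻ y in Q, ν y ^ (-1 / (q - 1)) ∂μ) ^ (q - 1)) := by
        gcongr
    _ = μ.withDensity ν Q * (∫⁻ y in Q, ν y ^ (-1 / (q - 1)) ∂μ) ^ (q - 1) * F := by ring
    _ ≤ (K * μ Q) ^ q * F := by
        gcongr
        exact h.withDensity_closedBall_mul_le hK hq hν hr

lemma IsWeight.exists_mul_measure_closedBall_le_of_lt_opL (hu : IsWeight u) (hf : AEMeasurable f)
    {A t : ℝ≥0∞} {x : Fin n → ℝ} (hx : maximal u x ≤ A * u x) (hx0 : u x ≠ 0) (hxt : u x ≠ ∞)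
    (ht : t < opL u f x) :
    ∃ (c : Fin n → ℝ) (r : ℝ), 0 < r ∧ x ∈ closedBall c r ∧
      t * volume.withDensity u (closedBall c r) ≤
        A * ∫⁻ y in closedBall c r, f y ∂(volume.withDensity u) := by
  rw [opL, ENNReal.lt_div_iff_mul_lt (.inl hx0) (.inl hxt)] at ht
  obtain ⟨c, r, hr, hxc, hav⟩ := lt_maximal_iff.1 ht
  refine ⟨c, r, hr, hxc, ?_⟩
  set Q := closedBall c r
  have hQ : MeasurableSet Q := isClosed_closedBall.measurableSet
  calc t * volume.withDensity u Q ≤ t * (A * u x * volume Q) := by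
        rw [withDensity_apply' u]
        gcongr
        exact (setLIntegral_closedBall_le u hr hxc).trans (by gcongr)
    _ = A * (t * u x * volume Q) := by ring
    _ ≤ A * ∫⁻ y in Q, u y * f y := by
        gcongr
        exact ENNReal.mul_le_of_le_div hav.le
    _ = A * ∫⁻ y in Q, f y ∂(volume.withDensity u) := by
        rw [restrict_withDensity hQ,
          lintegral_withDensity_eq_lintegral_mul₀ hu.aemeasurable.restrict hf.restrict]
        rfl

lemma IsA1.rpow_mul_withDensity_closedBall_five_mul_le (hu : IsA1 u)
    (h : IsRelativeA1 (volume.withDensity u) K fun y => ν y ^ (-1 / (q - 1))) (hK : 1 ≤ K)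
    (hq : 1 < q) (hf : AEMeasurable f) (hν : AEMeasurable ν) (hν0 : ∀ᵐ x, ν x ≠ 0)
    (hνt : ∀ᵐ x, ν x ≠ ∞) (hr : 0 < r) {t : ℝ≥0∞}
    (ht : t * volume.withDensity u (closedBall c r) ≤
      a1Const u * ∫⁻ y in closedBall c r, f y ∂(volume.withDensity u)) :
    t ^ q * (volume.withDensity u).withDensity ν (closedBall c (5 * r)) ≤
      (5 ^ n * K * a1Const u ^ 2) ^ q *
        ∫⁻ y in closedBall c r, f y ^ q * ν y ∂(volume.withDensity u) := by
  set μ := volume.withDensity u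
  set Q := closedBall c r
  set Q₅ := closedBall c (5 * r)
  have hμ : μ ≪ volume := withDensity_absolutelyContinuous _ _
  have hq0 : 0 ≤ q := by linarith
  have hQ0 : μ Q ^ q ≠ 0 := by
    simp [ENNReal.rpow_eq_zero_iff, hu.1.measure_closedBall_ne_zero c hr, hq0.not_gt, μ, Q]
  have hQt : μ Q ^ q ≠ ∞ :=
    ENNReal.rpow_ne_top_of_nonneg hq0 (hu.1.measure_closedBall_ne_top c r)
  rw [← ENNReal.mul_le_mul_iff_right hQ0 hQt]
  calc μ Q ^ q * (t ^ q * μ.withDensity ν Q₅) = μ.withDensity ν Q₅ * (t * μ Q) ^ q := by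
        rw [ENNReal.mul_rpow_of_nonneg _ _ hq0]
        ring
    _ ≤ μ.withDensity ν Q₅ * (a1Const u * ∫⁻ y in Q, f y ∂μ) ^ q := by gcongr
    _ = a1Const u ^ q * (μ.withDensity ν Q₅ * (∫⁻ y in Q, f y ∂μ) ^ q) := by
        rw [ENNReal.mul_rpow_of_nonneg _ _ hq0]
        ring
    _ ≤ a1Const u ^ q * ((K * (5 ^ n * a1Const u * μ Q)) ^ q *
          ∫⁻ y in Q, f y ^ q * ν y ∂μ) := by
        gcongr a1Const u ^ q * ?_
        refine (h.withDensity_closedBall_mul_rpow_setLIntegral_le hK hq (hf.mono_ac hμ)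
          (hν.mono_ac hμ) (hμ.ae_le hν0) (hμ.ae_le hνt) (by positivity)
          (closedBall_subset_closedBall (by linarith : r ≤ 5 * r))).trans ?_
        gcongr
        exact hu.measure_closedBall_five_mul_le c hr
    _ = (a1Const u * (K * (5 ^ n * a1Const u * μ Q))) ^ q * ∫⁻ y in Q, f y ^ q * ν y ∂μ := by
        rw [ENNReal.mul_rpow_of_nonneg (a1Const u) _ hq0, ← mul_assoc]
    _ = (μ Q * (5 ^ n * K * a1Const u ^ 2)) ^ q * ∫⁻ y in Q, f y ^ q * ν y ∂μ := by ring_nf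
    _ = μ Q ^ q * ((5 ^ n * K * a1Const u ^ 2) ^ q * ∫⁻ y in Q, f y ^ q * ν y ∂μ) := by
        rw [ENNReal.mul_rpow_of_nonneg _ _ hq0, mul_assoc]

lemma IsA1.rpow_mul_measure_lt_opL_le (hu : IsA1 u)
    (h : IsRelativeA1 (volume.withDensity u) K fun y => ν y ^ (-1 / (q - 1))) (hK : 1 ≤ K)
    (hq : 1 < q) (hf : AEMeasurable f) (hν : AEMeasurable ν) (hν0 : ∀ᵐ x, ν x ≠ 0)
    (hνt : ∀ᵐ x, ν x ≠ ∞) (t : ℝ≥0∞) :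
    t ^ q * volume.withDensity (fun x => u x * ν x) {x | t < opL u f x} ≤
      (5 ^ n * K * a1Const u ^ 2) ^ q *
        ∫⁻ y, f y ^ q ∂(volume.withDensity fun x => u x * ν x) := by
  set μ := volume.withDensity u
  set w := volume.withDensity fun x => u x * ν x
  set G := 5 ^ n * K * a1Const u ^ 2
  have hμ : μ ≪ volume := withDensity_absolutelyContinuous _ _
  have hw : w = μ.withDensity ν := withDensity_mul₀ hu.1.aemeasurable hν
  have hgood : {x | t < opL u f x} ≤ᵐ[w] {x | t < opL u f x ∧
      maximal u x ≤ a1Const u * u x ∧ u x ≠ 0 ∧ u x ≠ ∞} := by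
    refine (withDensity_absolutelyContinuous _ _ : w ≪ volume).ae_le ?_
    filter_upwards [hu.ae_maximal_le, hu.1.pos, hu.1.ae_lt_top] with x h1 h2 h3 ht
    exact ⟨ht, h1, h2.ne', h3.ne⟩
  have hcover : (t ^ q • w) {x | t < opL u f x ∧
      maximal u x ≤ a1Const u * u x ∧ u x ≠ 0 ∧ u x ≠ ∞} ≤
        (G ^ q • μ.withDensity fun y => f y ^ q * ν y) Set.univ := by
    refine measure_le_of_forall_closedBall fun x ⟨ht, hx, hx0, hxt⟩ => ?_
    obtain ⟨c, r, hr, hxc, hQ⟩ :=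
      hu.1.exists_mul_measure_closedBall_le_of_lt_opL hf hx hx0 hxt ht
    refine ⟨c, r, hr, hxc, ?_⟩
    rw [Measure.smul_apply, Measure.smul_apply, smul_eq_mul, smul_eq_mul, hw,
      withDensity_apply (fun y => f y ^ q * ν y) isClosed_closedBall.measurableSet]
    exact hu.rpow_mul_withDensity_closedBall_five_mul_le h hK hq hf hν hν0 hνt hr hQ
  calc t ^ q * w {x | t < opL u f x}
      ≤ (G ^ q • μ.withDensity fun y => f y ^ q * ν y) Set.univ :=
        (mul_le_mul' le_rfl (measure_mono_ae hgood)).trans hcover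
    _ = G ^ q * ∫⁻ y, f y ^ q ∂w := by
        rw [Measure.smul_apply, smul_eq_mul, withDensity_apply _ .univ, setLIntegral_univ, hw,
          lintegral_withDensity_eq_lintegral_mul₀ (hν.mono_ac hμ) ((hf.mono_ac hμ).pow_const q)]
        simp only [Pi.mul_apply, mul_comm]

end WeakType

/-! ### Lorentz norms -/

section Lorentz

variable {w f : (Fin n → ℝ) → ℝ≥0∞} {p q : ℝ} {a A Y l : ℝ≥0∞}

lemma tsum_rpow_le {ι : Type*} (a : ι → ℝ≥0∞) {s : ℝ} (hs : 0 < s) (hs1 : s ≤ 1) :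
    (∑' i, a i) ^ s ≤ ∑' i, a i ^ s := by
  have hsum (F : Finset ι) : (∑ i ∈ F, a i) ^ s ≤ ∑ i ∈ F, a i ^ s := by
    induction F using Finset.cons_induction with
    | empty => simp [hs]
    | cons i F hi ih =>
      rw [Finset.sum_cons, Finset.sum_cons]
      exact (ENNReal.rpow_add_le_add_rpow _ _ hs.le hs1).trans (by gcongr)
  refine le_of_tendsto' (((ENNReal.continuous_rpow_const (y := s)).tendsto _).comp
    ENNReal.summable.hasSum) fun F => ?_
  exact (hsum F).trans (ENNReal.sum_le_tsum F)

lemma setLIntegral_Ioi_comp_mul_left (F : ℝ → ℝ≥0∞) {b : ℝ} (hb : 0 < b) :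
    ∫⁻ t in Set.Ioi 0, F (b * t) = ENNReal.ofReal b⁻¹ * ∫⁻ t in Set.Ioi 0, F t := by
  have hemb := measurableEmbedding_mulLeft₀ hb.ne'
  have hpre : (b * ·) ⁻¹' Set.Ioi 0 = Set.Ioi 0 := by simp [Set.preimage_const_mul_Ioi₀ _ hb]
  calc ∫⁻ t in Set.Ioi 0, F (b * t)
      = ∫⁻ t in Set.Ioi 0, F t ∂(volume.map (b * ·)) := by
        rw [hemb.restrict_map, hemb.lintegral_map, hpre]
    _ = ENNReal.ofReal b⁻¹ * ∫⁻ t in Set.Ioi 0, F t := by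
        rw [Real.map_volume_mul_left hb.ne', Measure.restrict_smul, lintegral_smul_measure,
          abs_of_pos (inv_pos.2 hb), smul_eq_mul]

lemma measurable_measure_lt_rpow (w f : (Fin n → ℝ) → ℝ≥0∞) (a : ℝ≥0∞) (hp : 0 < p) :
    Measurable fun t : ℝ => volume.withDensity w {x | a * ENNReal.ofReal t < f x} ^ (1 / p) := by
  refine Antitone.measurable fun t t' ht => ?_
  gcongr

lemma ofReal_mul_setLIntegral_measure_mul_lt (w f : (Fin n → ℝ) → ℝ≥0∞) (p : ℝ) (ha0 : a ≠ 0)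
    (ha : a ≠ ∞) :
    ENNReal.ofReal p * ∫⁻ t in Set.Ioi (0 : ℝ),
        volume.withDensity w {x | a * ENNReal.ofReal t < f x} ^ (1 / p) =
      a⁻¹ * lorentzNorm p w f := by
  have hb : 0 < a.toReal := ENNReal.toReal_pos ha0 ha
  have h := setLIntegral_Ioi_comp_mul_left
    (fun t => volume.withDensity w {x | ENNReal.ofReal t < f x} ^ (1 / p)) hb
  simp only [ENNReal.ofReal_mul hb.le, ENNReal.ofReal_inv_of_pos hb, ENNReal.ofReal_toReal ha] at h
  rw [h, lorentzNorm]
  ring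

lemma lorentzNorm_div (w f : (Fin n → ℝ) → ℝ≥0∞) (p : ℝ) (ha0 : a ≠ 0) (ha : a ≠ ∞) :
    lorentzNorm p w (fun x => f x / a) = a⁻¹ * lorentzNorm p w f := by
  rw [← ofReal_mul_setLIntegral_measure_mul_lt w f p ha0 ha, lorentzNorm]
  simp only [ENNReal.lt_div_iff_mul_lt (Or.inl ha0) (Or.inl ha), mul_comm a]

lemma lorentzNorm_tsum_le {ι : Type*} [Countable ι] (w : (Fin n → ℝ) → ℝ≥0∞)
    (g : ι → (Fin n → ℝ) → ℝ≥0∞) (hp : 1 ≤ p) {a : ι → ℝ≥0∞} (ha0 : ∀ i, a i ≠ 0)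
    (ha : ∑' i, a i ≤ 1) :
    lorentzNorm p w (fun x => ∑' i, g i x) ≤ ∑' i, (a i)⁻¹ * lorentzNorm p w (g i) := by
  have hat (i : ι) : a i ≠ ∞ :=
    ne_top_of_le_ne_top ENNReal.one_ne_top ((ENNReal.le_tsum i).trans ha)
  have hp0 : 0 < p := by linarith
  have hcover (t : ℝ) : {x | ENNReal.ofReal t < ∑' i, g i x} ⊆
      ⋃ i, {x | a i * ENNReal.ofReal t < g i x} := by
    intro x hx
    by_contra! h
    simp only [Set.mem_iUnion, Set.mem_ofPred, not_exists, not_lt] at h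
    refine hx.not_ge ((ENNReal.tsum_le_tsum h).trans ?_)
    rw [ENNReal.tsum_mul_right]
    exact mul_le_of_le_one_left' ha
  simp only [← ofReal_mul_setLIntegral_measure_mul_lt w _ p (ha0 _) (hat _)]
  rw [ENNReal.tsum_mul_left, ← lintegral_tsum fun i =>
    (measurable_measure_lt_rpow w (g i) (a i) hp0).aemeasurable, lorentzNorm]
  gcongr with t
  calc volume.withDensity w {x | ENNReal.ofReal t < ∑' i, g i x} ^ (1 / p)
      ≤ (∑' i, volume.withDensity w {x | a i * ENNReal.ofReal t < g i x}) ^ (1 / p) := by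
        gcongr
        exact (measure_mono (hcover t)).trans (measure_iUnion_le _)
    _ ≤ ∑' i, volume.withDensity w {x | a i * ENNReal.ofReal t < g i x} ^ (1 / p) :=
        tsum_rpow_le _ (by positivity) (by rwa [div_le_one hp0])

lemma ae_lt_top_of_lorentzNorm_lt_top (hp : 0 < p) (hw : AEMeasurable w)
    (hw0 : ∀ᵐ x, w x ≠ 0) (hf : lorentzNorm p w f < ∞) : ∀ᵐ x, f x < ∞ := by
  set μ := volume.withDensity w
  have htop : ∫⁻ _ in Set.Ioi (0 : ℝ), μ {x | f x = ∞} ^ (1 / p) ≠ ∞ := by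
    refine ne_top_of_le_ne_top (ENNReal.lt_top_of_mul_ne_top_right hf.ne (by simpa)).ne ?_
    gcongr with t x
    exact fun hx => hx ▸ ENNReal.ofReal_lt_top
  rw [setLIntegral_const, Real.volume_Ioi] at htop
  have hzero : μ {x | f x = ∞} = 0 := by
    by_contra h
    exact htop (ENNReal.mul_top (by simp [ENNReal.rpow_eq_zero_iff, h, hp.le]))
  have hμ : ∀ᵐ x ∂μ, f x < ∞ := by simpa [ae_iff] using hzero
  filter_upwards [(ae_withDensity_iff' hw).1 hμ, hw0] with x hx hx0 using hx hx0

/-! ### Interpolation -/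

lemma mul_four_pow_rpow_le (A l : ℝ≥0∞) (hY : 1 ≤ Y) (hq : 0 ≤ q) (hpq : 3 * q ≤ p) (k : ℕ) :
    (A * Y ^ 3 * (4 ^ (k + 1) * l)) ^ q ≤ (A * l) ^ q * (Y * 2 ^ (k + 1)) ^ p := by
  have hbase : 1 ≤ Y * 2 ^ (k + 1) := one_le_mul hY (one_le_pow₀ (by norm_num))
  have hcube : (4 : ℝ≥0∞) ^ (k + 1) * Y ^ 3 ≤ (Y * 2 ^ (k + 1)) ^ 3 := by
    rw [mul_pow, ← pow_mul, mul_comm (k + 1), pow_mul, mul_comm]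
    gcongr
    norm_num
  calc (A * Y ^ 3 * (4 ^ (k + 1) * l)) ^ q = (A * l * (4 ^ (k + 1) * Y ^ 3)) ^ q := by ring_nf
    _ ≤ (A * l * (Y * 2 ^ (k + 1)) ^ 3) ^ q := by gcongr
    _ = (A * l) ^ q * (Y * 2 ^ (k + 1)) ^ (3 * q) := by
        rw [ENNReal.mul_rpow_of_nonneg _ _ hq, ENNReal.rpow_mul, ENNReal.rpow_ofNat]
    _ ≤ (A * l) ^ q * (Y * 2 ^ (k + 1)) ^ p := by gcongr

lemma measure_lt_rpow_le_tsum {X : Type*} [MeasurableSpace X] {μ : Measure X}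
    {f F G : X → ℝ≥0∞} (hA0 : A ≠ 0) (hA : A ≠ ∞) (hY : 1 ≤ Y) (hq : 1 ≤ q) (hpq : 3 * q ≤ p)
    (hl0 : l ≠ 0) (hl : l ≠ ∞) (hf : AEMeasurable f μ) (hF : ∀ᵐ x ∂μ, F x ≤ A * l + G x)
    (hG : (A * l) ^ q * μ {x | A * l < G x} ≤
      (A * Y ^ 3) ^ q * ∫⁻ x in {x | l < f x}, f x ^ q ∂μ) :
    μ {x | 2 * A * l < F x} ^ (1 / p) ≤
      ∑' k : ℕ, Y * 2 ^ (k + 1) * μ {x | 4 ^ k * l < f x} ^ (1 / p) := by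
  have hq0 : 0 ≤ q := by linarith
  have hp0 : 0 < p := by linarith
  have hsub : μ {x | 2 * A * l < F x} ≤ μ {x | A * l < G x} := by
    refine measure_mono_ae ?_
    filter_upwards [hF] with x hx (hlt : 2 * A * l < F x)
    rw [mul_assoc, two_mul] at hlt
    exact lt_of_add_lt_add_left (hlt.trans_le hx)
  have hlayers : μ {x | A * l < G x} ≤
      ∑' k : ℕ, (Y * 2 ^ (k + 1)) ^ p * μ {x | 4 ^ k * l < f x} := by
    have hAl0 : (A * l) ^ q ≠ 0 := by
      simp [ENNReal.rpow_eq_zero_iff, hA0, hl0, hq0]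
    have hAl : (A * l) ^ q ≠ ∞ := ENNReal.rpow_ne_top_of_nonneg hq0 (ENNReal.mul_ne_top hA hl)
    rw [← ENNReal.mul_le_mul_iff_right hAl0 hAl, ← ENNReal.tsum_mul_left]
    refine hG.trans ((mul_le_mul' le_rfl
      (setLIntegral_lt_rpow_le_tsum hf (by norm_num : (1 : ℝ≥0∞) ≤ 4) hl0 hq0)).trans ?_)
    rw [← ENNReal.tsum_mul_left]
    refine ENNReal.tsum_le_tsum fun k => ?_
    rw [← mul_assoc, ← mul_assoc, ← ENNReal.mul_rpow_of_nonneg _ _ hq0]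
    gcongr ?_ * _
    exact mul_four_pow_rpow_le A l hY hq0 hpq k
  calc μ {x | 2 * A * l < F x} ^ (1 / p)
      ≤ (∑' k : ℕ, (Y * 2 ^ (k + 1)) ^ p * μ {x | 4 ^ k * l < f x}) ^ (1 / p) := by
        gcongr
        exact hsub.trans hlayers
    _ ≤ ∑' k : ℕ, ((Y * 2 ^ (k + 1)) ^ p * μ {x | 4 ^ k * l < f x}) ^ (1 / p) :=
        tsum_rpow_le _ (by positivity) (by rw [div_le_one hp0]; linarith)
    _ = ∑' k : ℕ, Y * 2 ^ (k + 1) * μ {x | 4 ^ k * l < f x} ^ (1 / p) := by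
        refine tsum_congr fun k => ?_
        rw [ENNReal.mul_rpow_of_nonneg _ _ (by positivity), one_div,
          ENNReal.rpow_rpow_inv hp0.ne']

lemma inv_mul_lorentzNorm_le_tsum {ι : Type*} [Countable ι] {F : (Fin n → ℝ) → ℝ≥0∞} {b : ℝ≥0∞}
    {a c : ι → ℝ≥0∞} (hp : 0 < p) (hb0 : b ≠ 0) (hb : b ≠ ∞) (ha0 : ∀ i, a i ≠ 0)
    (ha : ∀ i, a i ≠ ∞)
    (h : ∀ t ∈ Set.Ioi (0 : ℝ),
      volume.withDensity w {x | b * ENNReal.ofReal t < F x} ^ (1 / p) ≤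
        ∑' i, c i * volume.withDensity w {x | a i * ENNReal.ofReal t < f x} ^ (1 / p)) :
    b⁻¹ * lorentzNorm p w F ≤ (∑' i, c i * (a i)⁻¹) * lorentzNorm p w f := by
  set μ := volume.withDensity w
  have hmeas (i : ι) := measurable_measure_lt_rpow w f (a i) hp
  calc b⁻¹ * lorentzNorm p w F
      = ENNReal.ofReal p * ∫⁻ t in Set.Ioi (0 : ℝ),
          μ {x | b * ENNReal.ofReal t < F x} ^ (1 / p) :=
        (ofReal_mul_setLIntegral_measure_mul_lt w F p hb0 hb).symm
    _ ≤ ENNReal.ofReal p * ∫⁻ t in Set.Ioi (0 : ℝ), ∑' i,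
          c i * μ {x | a i * ENNReal.ofReal t < f x} ^ (1 / p) := by
        gcongr ENNReal.ofReal p * ?_
        exact setLIntegral_mono' measurableSet_Ioi h
    _ = ∑' i, c i * (ENNReal.ofReal p * ∫⁻ t in Set.Ioi (0 : ℝ),
          μ {x | a i * ENNReal.ofReal t < f x} ^ (1 / p)) := by
        rw [lintegral_tsum fun i => ((hmeas i).const_mul _).aemeasurable, ← ENNReal.tsum_mul_left]
        refine tsum_congr fun i => ?_
        rw [lintegral_const_mul _ (hmeas i), mul_left_comm]
    _ = (∑' i, c i * (a i)⁻¹) * lorentzNorm p w f := by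
        rw [← ENNReal.tsum_mul_right]
        refine tsum_congr fun i => ?_
        rw [ofReal_mul_setLIntegral_measure_mul_lt w f p (ha0 i) (ha i), mul_assoc]

lemma lorentzNorm_le_of_weakType {T : ((Fin n → ℝ) → ℝ≥0∞) → (Fin n → ℝ) → ℝ≥0∞}
    (hA0 : A ≠ 0) (hA : A ≠ ∞) (hY : 1 ≤ Y) (hq : 1 ≤ q) (hpq : 3 * q ≤ p) (hf : AEMeasurable f)
    (hT : ∀ l ≠ ∞, ∀ᵐ x, T f x ≤ A * l + T ({x | l < f x}.indicator f) x)
    (hweak : ∀ g, AEMeasurable g → ∀ t, t ^ q * volume.withDensity w {x | t < T g x} ≤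
      (A * Y ^ 3) ^ q * ∫⁻ x, g x ^ q ∂(volume.withDensity w)) :
    lorentzNorm p w (T f) ≤ 8 * A * Y * lorentzNorm p w f := by
  set μ := volume.withDensity w
  have hμ : μ ≪ volume := withDensity_absolutelyContinuous _ _
  have hlevel (t : ℝ) (ht : t ∈ Set.Ioi (0 : ℝ)) :
      μ {x | 2 * A * ENNReal.ofReal t < T f x} ^ (1 / p) ≤
        ∑' k : ℕ, Y * 2 ^ (k + 1) * μ {x | 4 ^ k * ENNReal.ofReal t < f x} ^ (1 / p) := by
    set l := ENNReal.ofReal t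
    have hS : NullMeasurableSet {x | l < f x} := nullMeasurableSet_lt aemeasurable_const hf
    refine measure_lt_rpow_le_tsum hA0 hA hY hq hpq (ENNReal.ofReal_pos.2 ht).ne'
      ENNReal.ofReal_ne_top (hf.mono_ac hμ) (hμ.ae_le (hT l ENNReal.ofReal_ne_top))
      ((hweak _ (hf.indicator₀ hS) (A * l)).trans_eq ?_)
    rw [← lintegral_indicator₀ (hS.mono_ac hμ)]
    congr with x
    exact Set.indicator_comp_of_zero (g := (· ^ q)) (ENNReal.zero_rpow_of_pos (by linarith)) ▸ rfl
  have hscale := inv_mul_lorentzNorm_le_tsum (by linarith) (by simpa : 2 * A ≠ 0)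
    (by finiteness) (fun k => by simp) (fun k => by finiteness) hlevel
  have hsum : ∑' k : ℕ, Y * 2 ^ (k + 1) * ((4 : ℝ≥0∞) ^ k)⁻¹ = 4 * Y := by
    have hterm (k : ℕ) : Y * 2 ^ (k + 1) * ((4 : ℝ≥0∞) ^ k)⁻¹ = 2 * Y * 2⁻¹ ^ k := by
      rw [show (4 : ℝ≥0∞) = 2 * 2 by norm_num, mul_pow,
        ENNReal.mul_inv (Or.inl (by simp)) (Or.inl (by simp)), ENNReal.inv_pow]
      calc Y * 2 ^ (k + 1) * (2⁻¹ ^ k * 2⁻¹ ^ k) = 2 * Y * 2⁻¹ ^ k * (2 * 2⁻¹) ^ k := by ring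
        _ = 2 * Y * 2⁻¹ ^ k := by
          rw [ENNReal.mul_inv_cancel two_ne_zero ENNReal.ofNat_ne_top, one_pow, mul_one]
    simp only [hterm]
    rw [ENNReal.tsum_mul_left, ENNReal.tsum_geometric, ENNReal.one_sub_inv_two, inv_inv]
    ring
  calc lorentzNorm p w (T f) = 2 * A * ((2 * A)⁻¹ * lorentzNorm p w (T f)) :=
        (ENNReal.mul_inv_cancel_left (by simpa) (by finiteness)).symm
    _ ≤ 2 * A * (4 * Y * lorentzNorm p w f) := by rw [← hsum]; gcongr
    _ = 8 * A * Y * lorentzNorm p w f := by ring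

end Lorentz

/-! ### The Rubio de Francia iteration -/

section Iteration

variable {u w f g : (Fin n → ℝ) → ℝ≥0∞} {p K : ℝ}

lemma IsA1.opL_le_add (hu : IsA1 u) (f : (Fin n → ℝ) → ℝ≥0∞) {l : ℝ≥0∞} (hl : l ≠ ∞) :
    ∀ᵐ x, opL u f x ≤ a1Const u * l + opL u ({x | l < f x}.indicator f) x := by
  set g := {x | l < f x}.indicator f
  have hfg : f ≤ fun x => l + g x := by
    intro x
    by_cases hx : l < f x
    · exact (Set.indicator_of_mem (by exact hx) f).symm.le.trans le_add_self
    · exact (not_lt.1 hx).trans le_self_add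
  filter_upwards [hu.ae_maximal_le, hu.1.pos, hu.1.ae_lt_top] with x hx hx0 hxt
  refine ENNReal.div_le_of_le_mul ?_
  calc maximal (fun y => u y * f y) x
      ≤ maximal ((fun y => l * u y) + fun y => u y * g y) x := by
        refine maximal_mono (fun y => ?_) x
        calc u y * f y ≤ u y * (l + g y) := by gcongr; exact hfg y
          _ = l * u y + u y * g y := by ring
    _ ≤ maximal (fun y => l * u y) x + maximal (fun y => u y * g y) x :=
        maximal_add_le (hu.1.aemeasurable.const_mul l) x
    _ ≤ l * (a1Const u * u x) + maximal (fun y => u y * g y) x := by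
        gcongr
        exact (maximal_const_mul_le hl u x).trans (by gcongr)
    _ = (a1Const u * l + opL u g x) * u x := by
        rw [add_mul, opL, ENNReal.div_mul_cancel hx0.ne' hxt.ne]
        ring

lemma aemeasurable_opL (hu : AEMeasurable u) (f : (Fin n → ℝ) → ℝ≥0∞) : AEMeasurable (opL u f) :=
  (measurable_maximal _).aemeasurable.div hu

lemma aemeasurable_iterate_opL (hu : AEMeasurable u) (hg : AEMeasurable g) :
    ∀ k : ℕ, AEMeasurable ((opL u)^[k] g)
  | 0 => hg
  | k + 1 => by
    rw [Function.iterate_succ_apply']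
    exact aemeasurable_opL hu _

lemma aemeasurable_opR (hu : AEMeasurable u) (hg : AEMeasurable g) (K : ℝ) :
    AEMeasurable (opR u K g) := by
  unfold opR
  exact AEMeasurable.tsum fun k => (aemeasurable_iterate_opL hu hg k).div_const _

lemma le_opR (u : (Fin n → ℝ) → ℝ≥0∞) (K : ℝ) (g : (Fin n → ℝ) → ℝ≥0∞) : g ≤ opR u K g :=
  fun x => by
    simpa [opR] using ENNReal.le_tsum
      (f := fun k : ℕ => (opL u)^[k] g x / ENNReal.ofReal (2 ^ k * K ^ k)) 0

lemma lorentzNorm_iterate_opL_le (hu : AEMeasurable u) (hg : AEMeasurable g) {C : ℝ≥0∞}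
    (hL : ∀ f, AEMeasurable f → lorentzNorm p w (opL u f) ≤ C * lorentzNorm p w f) (k : ℕ) :
    lorentzNorm p w ((opL u)^[k] g) ≤ C ^ k * lorentzNorm p w g := by
  induction k with
  | zero => simp
  | succ k ih =>
    rw [Function.iterate_succ_apply', pow_succ', mul_assoc]
    exact (hL _ (aemeasurable_iterate_opL hu hg k)).trans (by gcongr)

lemma lorentzNorm_opR_le (hu : AEMeasurable u) (hp : 1 ≤ p) (hK : 0 < K)
    (hL : ∀ f, AEMeasurable f →
      lorentzNorm p w (opL u f) ≤ ENNReal.ofReal K * lorentzNorm p w f)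
    (hg : AEMeasurable g) :
    lorentzNorm p w (opR u (6 * K) g) ≤ 2 * lorentzNorm p w g := by
  have hgeom (b r : ℝ) (hb : 0 ≤ b) (hr : 0 ≤ r) (hr1 : r < 1) :
      ∑' k : ℕ, ENNReal.ofReal (b * r ^ k) = ENNReal.ofReal (b * (1 - r)⁻¹) := by
    rw [← ENNReal.ofReal_tsum_of_nonneg (fun k => by positivity)
      ((summable_geometric_of_lt_one hr hr1).mul_left b), tsum_mul_left,
      tsum_geometric_of_lt_one hr hr1]
  calc lorentzNorm p w (opR u (6 * K) g)
      ≤ ∑' k : ℕ, (ENNReal.ofReal (3 / 4 * (1 / 4) ^ k))⁻¹ *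
          lorentzNorm p w fun x => (opL u)^[k] g x / ENNReal.ofReal (2 ^ k * (6 * K) ^ k) := by
        refine lorentzNorm_tsum_le w _ hp (fun k => (ENNReal.ofReal_pos.2 (by positivity)).ne') ?_
        rw [hgeom _ _ (by norm_num) (by norm_num) (by norm_num)]
        norm_num
    _ ≤ ∑' k : ℕ, ENNReal.ofReal (4 / 3 * (1 / 3) ^ k) * lorentzNorm p w g := by
        refine ENNReal.tsum_le_tsum fun k => ?_
        rw [lorentzNorm_div w _ p (ENNReal.ofReal_pos.2 (by positivity)).ne'
          ENNReal.ofReal_ne_top]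
        refine (mul_le_mul' le_rfl (mul_le_mul' le_rfl
          (lorentzNorm_iterate_opL_le hu hg hL k))).trans_eq ?_
        rw [← mul_assoc, ← mul_assoc, ← ENNReal.ofReal_inv_of_pos (by positivity),
          ← ENNReal.ofReal_inv_of_pos (by positivity), ← ENNReal.ofReal_pow hK.le,
          ← ENNReal.ofReal_mul (by positivity), ← ENNReal.ofReal_mul (by positivity)]
        congr 2
        rw [← mul_pow, show 2 * (6 * K) = 3 * 4 * K by ring]
        simp only [mul_pow, div_pow, one_pow]
        field_simp
    _ = 2 * lorentzNorm p w g := by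
        rw [ENNReal.tsum_mul_right, hgeom _ _ (by norm_num) (by norm_num) (by norm_num)]
        norm_num

lemma IsWeight.maximal_mul_opR_le (hu : IsWeight u) (hK : 0 < K) (hg : AEMeasurable g) :
    ∀ᵐ x, maximal (fun y => u y * opR u K g y) x ≤
      ENNReal.ofReal (2 * K) * (u x * opR u K g x) := by
  set C := ENNReal.ofReal (2 * K)
  have hC0 : C ≠ 0 := (ENNReal.ofReal_pos.2 (by positivity)).ne'
  have hC : C ≠ ∞ := ENNReal.ofReal_ne_top
  have hopR (x : Fin n → ℝ) :
      u x * opR u K g x = ∑' k : ℕ, (C ^ k)⁻¹ * (u x * (opL u)^[k] g x) := by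
    rw [opR, ← ENNReal.tsum_mul_left]
    refine tsum_congr fun k => ?_
    rw [← mul_pow, ENNReal.ofReal_pow (by positivity), div_eq_mul_inv]
    ring
  filter_upwards [hu.pos, hu.ae_lt_top] with x h0 ht
  have hsucc (k : ℕ) :
      maximal (fun y => u y * (opL u)^[k] g y) x = u x * (opL u)^[k + 1] g x := by
    rw [Function.iterate_succ_apply', opL, ENNReal.mul_div_cancel h0.ne' ht.ne]
  calc maximal (fun y => u y * opR u K g y) x
      = maximal (fun y => ∑' k : ℕ, (C ^ k)⁻¹ * (u y * (opL u)^[k] g y)) x := by simp only [hopR]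
    _ ≤ ∑' k : ℕ, maximal (fun y => (C ^ k)⁻¹ * (u y * (opL u)^[k] g y)) x :=
        maximal_tsum_le (fun k => (hu.aemeasurable.mul
          (aemeasurable_iterate_opL hu.aemeasurable hg k)).const_mul _) x
    _ ≤ ∑' k : ℕ, (C ^ k)⁻¹ * (u x * (opL u)^[k + 1] g x) := by
        refine ENNReal.tsum_le_tsum fun k => ?_
        rw [← hsucc]
        exact maximal_const_mul_le (by simp [hC0]) _ x
    _ = C * ∑' k : ℕ, (C ^ (k + 1))⁻¹ * (u x * (opL u)^[k + 1] g x) := by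
        rw [← ENNReal.tsum_mul_left]
        refine tsum_congr fun k => ?_
        rw [pow_succ', ENNReal.mul_inv (Or.inl hC0) (Or.inl hC), mul_assoc,
          ENNReal.mul_inv_cancel_left hC0 hC]
    _ ≤ C * (u x * opR u K g x) := by
        rw [hopR]
        gcongr C * ?_
        exact ENNReal.tsum_comp_le_tsum_of_injective (add_left_injective 1) _

lemma isWeight_of_ae_maximal_le {v : (Fin n → ℝ) → ℝ≥0∞} {C : ℝ≥0∞} (hv : AEMeasurable v)
    (hv0 : ¬ v =ᵐ[volume] 0) (hvt : ∀ᵐ x, v x < ∞) (hC : C ≠ ∞)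
    (hM : ∀ᵐ x, maximal v x ≤ C * v x) : IsWeight v where
  aemeasurable := hv
  pos := by
    filter_upwards [hM] with x hx
    refine pos_iff_ne_zero.2 fun h => maximal_ne_zero hv hv0 x ?_
    simpa [h] using hx
  locallyIntegrable S hS := by
    obtain ⟨x, hx, hxt⟩ := (hM.and hvt).exists
    obtain ⟨r, hr, hSr⟩ : ∃ r > 0, S ⊆ closedBall x r := by
      obtain ⟨r, hr⟩ := hS.isBounded.subset_closedBall x
      exact ⟨max r 1, by positivity, hr.trans (closedBall_subset_closedBall (le_max_left _ _))⟩
    calc ∫⁻ y in S, v y ≤ ∫⁻ y in closedBall x r, v y := lintegral_mono_set hSr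
      _ ≤ maximal v x * volume (closedBall x r) :=
          setLIntegral_closedBall_le v hr (mem_closedBall_self hr.le)
      _ ≤ C * v x * volume (closedBall x r) := by gcongr
      _ < ∞ := by
          have := volume_closedBall_ne_top x r
          finiteness

lemma IsWeight.isA1_mul_opR (hu : IsWeight u) (hK : 0 < K) (hg : AEMeasurable g)
    (hg0 : ¬ g =ᵐ[volume] 0) (hfin : ∀ᵐ x, opR u K g x < ∞) :
    IsA1 (fun x => u x * opR u K g x) ∧
      a1Const (fun x => u x * opR u K g x) ≤ ENNReal.ofReal (2 * K) := by
  have hM := hu.maximal_mul_opR_le hK hg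
  have hconst : a1Const (fun x => u x * opR u K g x) ≤ ENNReal.ofReal (2 * K) := sInf_le hM
  refine ⟨⟨isWeight_of_ae_maximal_le (hu.aemeasurable.mul (aemeasurable_opR hu.aemeasurable hg K))
    (fun h => hg0 ?_) ?_ ENNReal.ofReal_ne_top hM, hconst.trans_lt ENNReal.ofReal_lt_top⟩, hconst⟩
  · filter_upwards [h, hu.pos] with x hx h0
    have hR : opR u K g x = 0 := (mul_eq_zero.1 hx).resolve_left h0.ne'
    exact le_zero_iff.1 ((le_opR u K g x).trans_eq hR)
  · filter_upwards [hu.ae_lt_top, hfin] with x h1 h2 using ENNReal.mul_lt_top h1 h2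

end Iteration

/-! ### Products of negative powers of maximal functions -/

section MaximalProduct

variable {N : ℕ} {h : Fin N → (Fin n → ℝ) → ℝ} {α : Fin N → ℝ} {s p q : ℝ}
  {u f : (Fin n → ℝ) → ℝ≥0∞} {x : Fin n → ℝ}

lemma IsA1.isRelativeA1_prod_maximal_rpow {ι : Type*} [Fintype ι] (hu : IsA1 u)
    (f : ι → (Fin n → ℝ) → ℝ≥0∞) {γ : ι → ℝ} (hγ : ∀ i, 0 ≤ γ i)
    (hγu : ENNReal.ofReal (∑ i, γ i) ≤ (8 * 175 ^ n * a1Const u)⁻¹) :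
    IsRelativeA1 (volume.withDensity u) (9 * 75 ^ n * a1Const u ^ 2)
      fun y => ∏ i, maximal (f i) y ^ γ i := by
  have hsum : 0 ≤ ∑ i, γ i := Finset.sum_nonneg fun i _ => hγ i
  generalize hΓsum : ∑ i, γ i = Γ at hsum hγu
  rcases hsum.eq_or_lt with hΓ | hΓ
  · have h0 (i : ι) : γ i = 0 :=
      (Finset.sum_eq_zero_iff_of_nonneg fun i _ => hγ i).1 (hΓsum.trans hΓ.symm) i
        (Finset.mem_univ i)
    simp only [h0, ENNReal.rpow_zero, Finset.prod_const_one]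
    exact isRelativeA1_one _ (one_le_mul (one_le_mul (by norm_num) (one_le_pow₀ (by norm_num)))
      (one_le_pow₀ hu.one_le_a1Const))
  · have hrel := IsRelativeA1.prod_rpow (θ := fun i => γ i / Γ)
      (fun i => hu.isRelativeA1_maximal_rpow (f i) hΓ hγu)
      (fun i => ((measurable_maximal (f i)).pow_const Γ).aemeasurable)
      (fun i => div_nonneg (hγ i) hΓ.le)
      (by rw [← Finset.sum_div, hΓsum, div_self hΓ.ne'])
    have hexp (i : ι) : Γ * (γ i / Γ) = γ i := mul_div_cancel₀ _ hΓ.ne'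
    simpa only [← ENNReal.rpow_mul, hexp] using hrel

lemma measurable_maximalProduct (h : Fin N → (Fin n → ℝ) → ℝ) (α : Fin N → ℝ) :
    Measurable (maximalProduct h α) :=
  Finset.measurable_fun_prod _ fun _ _ => (measurable_maximal _).pow_const _

lemma maximal_enorm_ne_zero {f : (Fin n → ℝ) → ℝ} (hf : AEStronglyMeasurable f)
    (h0 : ¬ f =ᵐ[volume] 0) (x : Fin n → ℝ) : maximal (fun y => ‖f y‖ₑ) x ≠ 0 :=
  maximal_ne_zero hf.enorm (fun h => h0 (h.mono fun y hy => by simpa using hy)) x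

lemma maximal_rpow_neg_ne_top {f : (Fin n → ℝ) → ℝ≥0∞} {a : ℝ} (ha : 0 ≤ a)
    (hx : maximal f x ≠ 0) : maximal f x ^ (-a) ≠ ∞ := by
  simp [ENNReal.rpow_eq_top_iff, hx, ha]

lemma maximalProduct_rpow_ne_top (hα : ∀ j, 0 ≤ α j) (hs : 0 ≤ s)
    (hx : ∀ j, maximal (fun y => ‖h j y‖ₑ) x ≠ 0) : maximalProduct h α x ^ s ≠ ∞ :=
  ENNReal.rpow_ne_top_of_nonneg hs
    (ENNReal.prod_ne_top fun j _ => maximal_rpow_neg_ne_top (hα j) (hx j))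

lemma maximalProduct_rpow_ne_zero (hα : ∀ j, 0 ≤ α j) (hs : 0 ≤ s)
    (hx : ∀ j, maximal (fun y => ‖h j y‖ₑ) x ≠ ∞) : maximalProduct h α x ^ s ≠ 0 := by
  have hprod : maximalProduct h α x ≠ 0 :=
    Finset.prod_ne_zero_iff.2 fun j _ => by simp [ENNReal.rpow_eq_zero_iff, hx j, hα j]
  simp [ENNReal.rpow_eq_zero_iff, hprod, hs]

lemma maximalProduct_rpow_rpow (hα : ∀ j, 0 ≤ α j)
    (hx : ∀ j, maximal (fun y => ‖h j y‖ₑ) x ≠ 0) (s e : ℝ) :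
    (maximalProduct h α x ^ s) ^ (-1 / e) =
      ∏ j, maximal (fun y => ‖h j y‖ₑ) x ^ (s * α j / e) := by
  rw [maximalProduct, ← ENNReal.rpow_mul,
    ← ENNReal.prod_rpow_of_ne_top fun j _ => maximal_rpow_neg_ne_top (hα j) (hx j)]
  refine Finset.prod_congr rfl fun j _ => ?_
  rw [← ENNReal.rpow_mul]
  ring_nf

lemma IsA1.isRelativeA1_maximalProduct_rpow (hu : IsA1 u) (hα : ∀ j, 0 ≤ α j) (hs : 0 ≤ s)
    (hne : ∀ j x, maximal (fun y => ‖h j y‖ₑ) x ≠ 0) (hq : 1 < q)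
    (hqu : 8 * 175 ^ n * (s * ∑ j, α j) * (a1Const u).toReal ≤ q - 1) :
    IsRelativeA1 (volume.withDensity u) (9 * 75 ^ n * a1Const u ^ 2)
      fun y => (maximalProduct h α y ^ s) ^ (-1 / (q - 1)) := by
  have hq0 : 0 < q - 1 := by linarith
  have hconst : 8 * 175 ^ n * a1Const u = ENNReal.ofReal (8 * 175 ^ n * (a1Const u).toReal) := by
    rw [ENNReal.ofReal_mul (by positivity), ENNReal.ofReal_toReal hu.2.ne,
      ENNReal.ofReal_mul (by norm_num), ENNReal.ofReal_pow (by norm_num), ENNReal.ofReal_ofNat,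
      ENNReal.ofReal_ofNat]
  simp only [maximalProduct_rpow_rpow hα (hne · _)]
  refine hu.isRelativeA1_prod_maximal_rpow _ (fun j => div_nonneg (mul_nonneg hs (hα j)) hq0.le) ?_
  rw [← Finset.sum_div, ← Finset.mul_sum, ENNReal.le_inv_iff_mul_le, hconst,
    ← ENNReal.ofReal_mul' (by positivity), ENNReal.ofReal_le_one, div_mul_eq_mul_div,
    div_le_one hq0]
  linarith

lemma ae_maximalProduct_rpow_ne_zero (hα : ∀ j, 0 ≤ α j) (hs : 0 ≤ s)
    (hfin : ∀ j, ∀ᵐ x, maximal (fun y => ‖h j y‖ₑ) x < ∞) :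
    ∀ᵐ x, maximalProduct h α x ^ s ≠ 0 :=
  (ae_all_iff.2 hfin).mono fun _ hx => maximalProduct_rpow_ne_zero hα hs fun j => (hx j).ne

lemma IsA1.rpow_mul_measure_lt_opL_maximalProduct_le (hu : IsA1 u) (hα : ∀ j, 0 ≤ α j)
    (hs : 0 ≤ s) (hne : ∀ j x, maximal (fun y => ‖h j y‖ₑ) x ≠ 0)
    (hfin : ∀ j, ∀ᵐ x, maximal (fun y => ‖h j y‖ₑ) x < ∞) (hq : 1 < q)
    (hqu : 8 * 175 ^ n * (s * ∑ j, α j) * (a1Const u).toReal ≤ q - 1) (hf : AEMeasurable f)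
    (t : ℝ≥0∞) :
    t ^ q * volume.withDensity (fun x => u x * maximalProduct h α x ^ s) {x | t < opL u f x} ≤
      (9 * 375 ^ n * a1Const u ^ 4) ^ q *
        ∫⁻ y, f y ^ q ∂(volume.withDensity fun x => u x * maximalProduct h α x ^ s) := by
  have hK : 1 ≤ 9 * 75 ^ n * a1Const u ^ 2 :=
    one_le_mul (one_le_mul (by norm_num) (one_le_pow₀ (by norm_num)))
      (one_le_pow₀ hu.one_le_a1Const)
  refine (hu.rpow_mul_measure_lt_opL_le (hu.isRelativeA1_maximalProduct_rpow hα hs hne hq hqu)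
    hK hq hf ((measurable_maximalProduct h α).pow_const s).aemeasurable
    (ae_maximalProduct_rpow_ne_zero hα hs hfin)
    (.of_forall fun x => maximalProduct_rpow_ne_top hα hs (hne · x)) t).trans_eq ?_
  rw [show (375 : ℝ≥0∞) = 5 * 75 by norm_num, mul_pow]
  ring_nf

lemma IsA1.lorentzNorm_opL_le (hu : IsA1 u) (hα : ∀ j, 0 ≤ α j) (hs : 0 ≤ s)
    (hne : ∀ j x, maximal (fun y => ‖h j y‖ₑ) x ≠ 0)
    (hfin : ∀ j, ∀ᵐ x, maximal (fun y => ‖h j y‖ₑ) x < ∞) (hq : 1 < q)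
    (hqu : 8 * 175 ^ n * (s * ∑ j, α j) * (a1Const u).toReal ≤ q - 1) (hpq : 3 * q ≤ p)
    (hf : AEMeasurable f) :
    lorentzNorm p (fun x => u x * maximalProduct h α x ^ s) (opL u f) ≤
      ENNReal.ofReal (72 * 375 ^ n * (a1Const u).toReal ^ 2) *
        lorentzNorm p (fun x => u x * maximalProduct h α x ^ s) f := by
  have hA : 1 ≤ a1Const u := hu.one_le_a1Const
  set B : ℝ≥0∞ := 9 * 375 ^ n
  have hB : 1 ≤ B := one_le_mul (by norm_num) (one_le_pow₀ (by norm_num))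
  have hconst : 8 * a1Const u * (B * a1Const u) =
      ENNReal.ofReal (72 * 375 ^ n * (a1Const u).toReal ^ 2) := by
    rw [ENNReal.ofReal_mul (by positivity), ENNReal.ofReal_pow (by positivity),
      ENNReal.ofReal_toReal hu.2.ne, ENNReal.ofReal_mul (by norm_num),
      ENNReal.ofReal_pow (by norm_num), ENNReal.ofReal_ofNat, ENNReal.ofReal_ofNat]
    ring
  rw [← hconst]
  refine lorentzNorm_le_of_weakType (one_pos.trans_le hA).ne' hu.2.ne (one_le_mul hB hA) hq.le
    hpq hf (fun l hl => hu.opL_le_add f hl) fun g hg t => ?_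
  refine (hu.rpow_mul_measure_lt_opL_maximalProduct_le hα hs hne hfin hq hqu hg t).trans ?_
  gcongr ?_ ^ q * _
  calc B * a1Const u ^ 4
      ≤ B ^ 3 * a1Const u ^ 4 := by gcongr; exact le_self_pow₀ hB (by norm_num)
    _ = a1Const u * (B * a1Const u) ^ 3 := by ring

lemma IsA1.ae_lt_top_of_lorentzNorm_maximalProduct_lt_top (hu : IsA1 u) (hα : ∀ j, 0 ≤ α j)
    (hs : 0 ≤ s) (hfin : ∀ j, ∀ᵐ x, maximal (fun y => ‖h j y‖ₑ) x < ∞) (hp : 0 < p)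
    (hf : lorentzNorm p (fun x => u x * maximalProduct h α x ^ s) f < ∞) : ∀ᵐ x, f x < ∞ := by
  refine ae_lt_top_of_lorentzNorm_lt_top hp
    (hu.1.aemeasurable.mul ((measurable_maximalProduct h α).pow_const s).aemeasurable) ?_ hf
  filter_upwards [hu.1.pos, ae_maximalProduct_rpow_ne_zero hα hs hfin] with x hux hνx
    using mul_ne_zero hux.ne' hνx

end MaximalProduct

end RestrictedWeights

open RestrictedWeights in
theorem proposition2p4_general (n N : ℕ) (α : Fin N → ℝ) (hα : ∀ j, 0 ≤ α j) (s : ℝ)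
    (hs : 0 ≤ s) :
    ∃ c C : ℝ, 0 < c ∧ 0 < C ∧
      ∀ (u₀ : (Fin n → ℝ) → ℝ≥0∞) (h : Fin N → (Fin n → ℝ) → ℝ), IsA1 u₀ →
        (∀ j, AEStronglyMeasurable (h j)) → (∀ j, ¬ h j =ᵐ[volume] 0) →
        (∀ j, ∀ᵐ x, maximal (fun y => ‖h j y‖ₑ) x < ∞) →
        ∃ p₀ K₀ : ℝ, 1 < p₀ ∧ 0 < K₀ ∧
          c * (a1Const u₀).toReal ≤ p₀ ∧ p₀ ≤ C * (a1Const u₀).toReal ∧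
          c * (a1Const u₀).toReal ^ 2 ≤ K₀ ∧ K₀ ≤ C * (a1Const u₀).toReal ^ 2 ∧
          (∀ p : ℝ, p₀ ≤ p → ∀ f : (Fin n → ℝ) → ℝ≥0∞, AEMeasurable f →
            lorentzNorm p (fun x => u₀ x * maximalProduct h α x ^ s) (opL u₀ f) ≤
              ENNReal.ofReal K₀ *
                lorentzNorm p (fun x => u₀ x * maximalProduct h α x ^ s) f) ∧
          (∀ g : (Fin n → ℝ) → ℝ≥0∞, ∀ x, g x ≤ opR u₀ K₀ g x) ∧
          (∀ p : ℝ, p₀ ≤ p → ∀ g : (Fin n → ℝ) → ℝ≥0∞, AEMeasurable g →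
            ¬ g =ᵐ[volume] 0 →
            lorentzNorm p (fun x => u₀ x * maximalProduct h α x ^ s) g < ∞ →
            IsA1 (fun x => u₀ x * opR u₀ K₀ g x) ∧
              a1Const (fun x => u₀ x * opR u₀ K₀ g x) ≤ ENNReal.ofReal (2 * K₀)) ∧
          (∀ p : ℝ, p₀ ≤ p → ∀ g : (Fin n → ℝ) → ℝ≥0∞, AEMeasurable g →
            lorentzNorm p (fun x => u₀ x * maximalProduct h α x ^ s) (opR u₀ K₀ g) ≤
              2 * lorentzNorm p (fun x => u₀ x * maximalProduct h α x ^ s) g) := by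
  obtain ⟨D, hD⟩ : ∃ D, D = 8 * 175 ^ n * (s * ∑ j, α j) := ⟨_, rfl⟩
  have hD0 : 0 ≤ D :=
    hD ▸ mul_nonneg (by positivity) (mul_nonneg hs (Finset.sum_nonneg fun j _ => hα j))
  refine ⟨1, 6 + 3 * D + 432 * 375 ^ n, one_pos, by positivity, fun u h hu hm hne hfin => ?_⟩
  obtain ⟨a, ha⟩ : ∃ a, a = (a1Const u).toReal := ⟨_, rfl⟩
  have ha1 : 1 ≤ a := by simpa [ha] using ENNReal.toReal_mono hu.2.ne hu.one_le_a1Const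
  obtain ⟨q, hq⟩ : ∃ q, q = 1 + (1 + D) * a := ⟨_, rfl⟩
  obtain ⟨K, hK⟩ : ∃ K, K = 72 * 375 ^ n * a ^ 2 := ⟨_, rfl⟩
  have hDa : 0 ≤ D * a := by positivity
  have hDa' : 0 ≤ D * a ^ 2 := by positivity
  have hKa : 0 ≤ 375 ^ n * a := by positivity
  have hKa' : a ^ 2 ≤ 375 ^ n * a ^ 2 :=
    le_mul_of_one_le_left (by positivity) (one_le_pow₀ (by norm_num))
  have ha2 : 0 < a ^ 2 := by positivity
  set w : (Fin n → ℝ) → ℝ≥0∞ := fun x => u x * maximalProduct h α x ^ s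
  have hL (p : ℝ) (hp : 3 * q ≤ p) (f : (Fin n → ℝ) → ℝ≥0∞) (hf : AEMeasurable f) :
      lorentzNorm p w (opL u f) ≤ ENNReal.ofReal K * lorentzNorm p w f := by
    rw [hK, ha]
    exact hu.lorentzNorm_opL_le hα hs (fun j => maximal_enorm_ne_zero (hm j) (hne j)) hfin
      (by linarith) (by rw [← hD, ← ha]; linarith) hp hf
  have hR (p : ℝ) (hp : 3 * q ≤ p) (g : (Fin n → ℝ) → ℝ≥0∞) (hg : AEMeasurable g) :
      lorentzNorm p w (opR u (6 * K) g) ≤ 2 * lorentzNorm p w g :=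
    lorentzNorm_opR_le hu.1.aemeasurable (by linarith) (by linarith) (hL p hp) hg
  rw [← ha]
  refine ⟨3 * q, 6 * K, by linarith, by linarith, by linarith, by linarith, by linarith,
    by linarith, fun p hp f hf => ?_, le_opR u _, fun p hp g hg hg0 hgt => ?_, hR⟩
  · exact (hL p hp f hf).trans (mul_le_mul_left (ENNReal.ofReal_le_ofReal (by linarith)) _)
  · exact hu.1.isA1_mul_opR (by linarith) hg hg0 <|
      hu.ae_lt_top_of_lorentzNorm_maximalProduct_lt_top (p := p) hα hs hfin (by linarith)
        ((hR p hp g hg).trans_lt (ENNReal.mul_lt_top ENNReal.ofNat_lt_top hgt))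

open RestrictedWeights in
theorem proposition2p4 (n : ℕ) (hn : 1 ≤ n) (N : ℕ) (α : Fin N → ℝ) (hα : ∀ j, 0 < α j)
    (s : ℝ) (hs : 1 ≤ s) :
    ∃ c C : ℝ, 0 < c ∧ 0 < C ∧
      ∀ (u₀ : (Fin n → ℝ) → ℝ≥0∞) (h : Fin N → (Fin n → ℝ) → ℝ), IsA1 u₀ →
        (∀ j, LocallyIntegrable (h j)) → (∀ j, ¬ h j =ᵐ[volume] 0) →
        (∀ j, ∀ᵐ x, maximal (fun y => ‖h j y‖ₑ) x < ∞) →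
        ∃ p₀ K₀ : ℝ, 1 < p₀ ∧ 0 < K₀ ∧
          c * (a1Const u₀).toReal ≤ p₀ ∧ p₀ ≤ C * (a1Const u₀).toReal ∧
          c * (a1Const u₀).toReal ^ 2 ≤ K₀ ∧ K₀ ≤ C * (a1Const u₀).toReal ^ 2 ∧
          -- `L` is bounded on `L^{p,1}(u₀ ν^s)` with norm at most `K₀`, for every `p ≥ p₀`
          (∀ p : ℝ, p₀ ≤ p → ∀ f : (Fin n → ℝ) → ℝ≥0∞, AEMeasurable f →
            lorentzNorm p (fun x => u₀ x * maximalProduct h α x ^ s) (opL u₀ f) ≤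
              ENNReal.ofReal K₀ *
                lorentzNorm p (fun x => u₀ x * maximalProduct h α x ^ s) f) ∧
          -- (1)
          (∀ g : (Fin n → ℝ) → ℝ≥0∞, ∀ x, g x ≤ opR u₀ K₀ g x) ∧
          -- (2)
          (∀ p : ℝ, p₀ ≤ p → ∀ g : (Fin n → ℝ) → ℝ≥0∞, AEMeasurable g →
            ¬ g =ᵐ[volume] 0 →
            lorentzNorm p (fun x => u₀ x * maximalProduct h α x ^ s) g < ∞ →
            IsA1 (fun x => u₀ x * opR u₀ K₀ g x) ∧
              a1Const (fun x => u₀ x * opR u₀ K₀ g x) ≤ ENNReal.ofReal (2 * K₀)) ∧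
          -- (3)
          (∀ p : ℝ, p₀ ≤ p → ∀ g : (Fin n → ℝ) → ℝ≥0∞, AEMeasurable g →
            lorentzNorm p (fun x => u₀ x * maximalProduct h α x ^ s) (opR u₀ K₀ g) ≤
              2 * lorentzNorm p (fun x => u₀ x * maximalProduct h α x ^ s) g) := by
  obtain ⟨c, C, hc, hC, H⟩ := proposition2p4_general n N α (fun j => (hα j).le) s (by linarith)
  exact ⟨c, C, hc, hC, fun u₀ h hu hloc => H u₀ h hu fun j => (hloc j).aestronglyMeasurable⟩
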